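/- **Parameters.** Order and parameter sequences are $\mathbf O=(m,n,p,q)$ with $0\le n\le p$, $0\le m\le q$, and $\mathbf P=(u,v,\mathbf c,\mathbf d,\mathbf C,\mathbf D)$ with $u\in\mathbb R$, $v>0$, $\mathbf c\in\mathbb R^p$, $\mathbf d\in\mathbb R^q$, $C_j,D_j>0$. Put $$\Phi(z)=\frac{\prod_{j=1}^m\Gamma(d_j-D_jz)\prod_{j=1}^n\Gamma(1-c_j+C_jz)}{\prod_{j=n+1}^p\Gamma(c_j-C_jz)\prod_{j=m+1}^q\Gamma(1-d_j+D_jz)},\qquad H[s,\mathbf O,\mathbf P]=\frac{u}{2\pi i}\int_{\sigma-i\infty}^{\sigma+i\infty}\Phi(z)(vs)^z\,dz\quad(s>0),$$ where the line $\operatorname{Re}z=\sigma$ separates the poles of the factors $\Gamma(d_j-D_jz)$, $j\le m$ (on its right) from those of $\Gamma(1-c_j+C_jz)$, $j\le n$ (on its left), and the integral converges absolutely; the function exists if there is such a line. **Multivariate function.** For $A>0$ and $s_j>0$ let $$H^{0,1}_{1,0}\!\left[\begin{matrix}(1-A,\mathbf 1_N)\\ \text{---}\end{matrix}:(s_j,\mathbf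 O_j,\mathbf P_j)_{1,N}\right]=\frac{u_1\cdots u_N}{(2\pi i)^N}\int_{\mathcal L_1}\!\!\cdots\!\int_{\mathcal L_N}\Gamma\Big(A+\sum_{l=1}^N\zeta_l\Big)\prod_{j=1}^N\Phi_j(\zeta_j)(v_js_j)^{\zeta_j}\,d\zeta_1\cdots d\zeta_N,$$ where $\mathcal L_j$ is a line $\operatorname{Re}\zeta_j=\sigma_j$ separating the poles of $\Phi_j$ as above, $A+\sum_l\sigma_l>0$, and the integral converges absolutely. **Mellin operation.** For $\mathbf O_f=(m,n,p,q)$ and $\mathbf P_f=(u,v,\mathbf c,\mathbf d,\mathbf C,\mathbf D)$ let $\mathbf O_\phi=(n+1,m,q,p+1)$ and $\mathbf P_\phi=\big(\tfrac uv,\tfrac1v,\mathbf 1-\mathbf d-\mathbf D,(0,\mathbf 1-\mathbf c-\mathbf C),\mathbf D,(1,\mathbf C)\big)$. This is $\mathbf O_{\mathrm{MGF}}\boxdot\mathbf O_f$ and $\mathbf P_{\mathrm{MGF}}\boxdot\mathbf P_f$ with $\mathbf O_{\mathrm{MGF}}=(1,0,0,1)$, $\mathbf P_{\mathrm{MGF}}=(1,1,\text{---},0,\text{---},1)$.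 **Theorem.** Let $N\ge1$, $\rho,\theta,T,B>0$, $A=\theta TB/\ln2$. Let the channel power gains $\gamma_1,\dots,\gamma_N$ be independent, not necessarily identically distributed, and let $\gamma_j$ follow hyper Fox's $H$ fading: it has on $(0,\infty)$ the density $$f_j(x)=\sum_{k=1}^{K_j}H[x,\mathbf O_{f_{j,k}},\mathbf P_{f_{j,k}}]\ge0,$$ where each $H$-function exists and its parameters satisfy $c_i+C_i<1$ for $i\le n$ and $-d_i/D_i<1$ for $i\le m$. Let $\mathbf O_{\phi_{j,k}},\mathbf P_{\phi_{j,k}}$ be obtained from $\mathbf O_{f_{j,k}},\mathbf P_{f_{j,k}}$ by the Mellin operation. Then the $H[\,\cdot\,,\mathbf O_{\phi_{j,k}},\mathbf P_{\phi_{j,k}}]$ exist and give the moment generating functions, $\mathbb E[e^{-s\gamma_j}]=\sum_{k=1}^{K_j}H[s,\mathbf O_{\phi_{j,k}},\mathbf P_{\phi_{j,k}}]$ for $s>0$; the multivariate functions below exist; their sum is a positive real number; and the effective rate $R(\theta)=-\frac1A\log_2\mathbb E\big[(1+\frac\rho N\sum_{j=1}^N\gamma_j)^{-A}\big]$ is $$R(\theta)=-\frac1A\log_2\left(\frac1{\Gamma(A)}\sum_{k_1=1}^{K_1}\cdots\sum_{k_N=1}^{K_N}H^{0,1}_{1,0}\!\left[\begin{matrix}(1-A,\mathbf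 1_N)\\ \text{---}\end{matrix}:\Big(\frac\rho N,\mathbf O_{\phi_{j,k_j}},\mathbf P_{\phi_{j,k_j}}\Big)_{1,N}\right]\right).$$ -/

import Mathlib

open MeasureTheory ProbabilityTheory

/-- Order and parameter sequences `O = (m, n, p, q)`, `P = (u, v, c, d, C, D)` of a univariate
Fox H-function. The entries are kept as pairs `(c_j, C_j)` and `(d_j, D_j)`, split at the places
`n` and `m`, so that `c = (cNum, cDen)` and `d = (dNum, dDen)`. -/
structure FoxHParam where
  /-- the multiplicative constant `u` -/
  u : ℝ
  /-- the scale `v` of the argument -/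
  v : ℝ
  /-- `(c_j, C_j)` for `1 ≤ j ≤ n` -/
  cNum : List (ℝ × ℝ)
  /-- `(c_j, C_j)` for `n < j ≤ p` -/
  cDen : List (ℝ × ℝ)
  /-- `(d_j, D_j)` for `1 ≤ j ≤ m` -/
  dNum : List (ℝ × ℝ)
  /-- `(d_j, D_j)` for `m < j ≤ q` -/
  dDen : List (ℝ × ℝ)

namespace FoxHParam

/-- The order sequence `O = (m, n, p, q)`. -/
def order (P : FoxHParam) : ℕ × ℕ × ℕ × ℕ :=
  (P.dNum.length, P.cNum.length, P.cNum.length + P.cDen.length, P.dNum.length + P.dDen.length)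

/-- The Mellin-Barnes kernel
`Φ(z) = ∏_{j≤m} Γ(d_j - D_j z) ∏_{j≤n} Γ(1 - c_j + C_j z) /
  (∏_{j>n} Γ(c_j - C_j z) ∏_{j>m} Γ(1 - d_j + D_j z))`.
At a pole of a Gamma factor of the denominator the quotient is `0`, which is the value of `1/Γ`. -/
noncomputable def kernel (P : FoxHParam) (z : ℂ) : ℂ :=
  ((P.dNum.map fun r => Complex.Gamma ((r.1 : ℂ) - (r.2 : ℂ) * z)).prod *
      (P.cNum.map fun r => Complex.Gamma (1 - (r.1 : ℂ) + (r.2 : ℂ) * z)).prod) /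
    ((P.cDen.map fun r => Complex.Gamma ((r.1 : ℂ) - (r.2 : ℂ) * z)).prod *
      (P.dDen.map fun r => Complex.Gamma (1 - (r.1 : ℂ) + (r.2 : ℂ) * z)).prod)

/-- The line `Re z = σ` separates the poles of the factors `Γ(d_j - D_j z)`, `j ≤ m` (to the right
of it) from those of the factors `Γ(1 - c_j + C_j z)`, `j ≤ n` (to the left of it). -/
def Separates (P : FoxHParam) (σ : ℝ) : Prop :=
  (∀ r ∈ P.dNum, 0 < r.1 - r.2 * σ) ∧ (∀ r ∈ P.cNum, 0 < 1 - r.1 + r.2 * σ)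

/-- The line `Re z = σ` is a suitable Mellin-Barnes contour: it separates the poles and the
integral along it converges absolutely. For `v s > 0` the factor `(v s)^z` of the integrand has the
constant modulus `(v s)^σ` on the line and does not matter here. -/
def IsContour (P : FoxHParam) (σ : ℝ) : Prop :=
  P.Separates σ ∧ Integrable (fun y : ℝ => P.kernel ((σ : ℂ) + (y : ℂ) * Complex.I))

/-- Abscissa of a suitable contour (an arbitrary real number if there is none). -/
noncomputable def contour (P : FoxHParam) : ℝ := Classical.epsilon P.IsContour

/-- The Fox H-function `H[s, O, P] = u / (2πi) ∫_L Φ(z) (v s)^z dz`, for `s > 0`;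
on the line `z = σ + i y` one has `dz = i dy`. -/
noncomputable def foxH (P : FoxHParam) (s : ℝ) : ℂ :=
  ((P.u : ℂ) / (2 * (Real.pi : ℂ))) *
    ∫ y : ℝ, P.kernel ((P.contour : ℂ) + (y : ℂ) * Complex.I) *
      ((P.v * s : ℝ) : ℂ) ^ ((P.contour : ℂ) + (y : ℂ) * Complex.I)

/-- The Mellin operation on parameter sequences:
`(u₁u₂/v₂, v₁/v₂, c'', d'', C'', D'')` with
`c'' = (ċ₁, 1 - d₂ - D₂, c̈₁)`, `C'' = (Ċ₁, D₂, C̈₁)`,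
`d'' = (ḋ₁, 1 - c₂ - C₂, d̈₁)`, `D'' = (Ḋ₁, C₂, D̈₁)`. -/
noncomputable def mellinOp (P₁ P₂ : FoxHParam) : FoxHParam where
  u := P₁.u * P₂.u / P₂.v
  v := P₁.v / P₂.v
  cNum := P₁.cNum ++ P₂.dNum.map fun r => (1 - r.1 - r.2, r.2)
  cDen := (P₂.dDen.map fun r => (1 - r.1 - r.2, r.2)) ++ P₁.cDen
  dNum := P₁.dNum ++ P₂.cNum.map fun r => (1 - r.1 - r.2, r.2)
  dDen := (P₂.cDen.map fun r => (1 - r.1 - r.2, r.2)) ++ P₁.dDen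

/-- The orders under the Mellin operation:
`(m₁, n₁, p₁, q₁)`, `(m₂, n₂, p₂, q₂)` give `(m₁ + n₂, m₂ + n₁, p₁ + q₂, p₂ + q₁)`. -/
theorem order_mellinOp (P₁ P₂ : FoxHParam) :
    (mellinOp P₁ P₂).order =
      (P₁.order.1 + P₂.order.2.1, P₂.order.1 + P₁.order.2.1,
        P₁.order.2.2.1 + P₂.order.2.2.2, P₂.order.2.2.1 + P₁.order.2.2.2) := by
  simp only [order, mellinOp, List.length_append, List.length_map, Prod.mk.injEq, true_and]
  refine ⟨?_, ?_, ?_⟩ <;> omega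

/-- `O_MGF = (1, 0, 0, 1)`, `P_MGF = (1, 1, -, 0, -, 1)`: the parameters of `e^{-s}`. -/
def mgfParam : FoxHParam where
  u := 1
  v := 1
  cNum := []
  cDen := []
  dNum := [(0, 1)]
  dDen := []

/-- The parameters `P_φ = P_MGF ⊡ P_f` of the moment generating function that belong to the
parameters `P_f` of a density. -/
noncomputable def toMGF (P : FoxHParam) : FoxHParam := mellinOp mgfParam P

/-- The conditions on the parameters of a component of a hyper Fox H density: positive scale `v`,
positive coefficients `C_j`, `D_j`, the conditions `c_j + C_j < 1` for `j ≤ n` and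
`- d_j / D_j < 1` for `j ≤ m`, and the existence of a suitable contour, that is, of the
H-function. -/
structure IsDensityComponent (P : FoxHParam) : Prop where
  v_pos : 0 < P.v
  C_pos : ∀ r ∈ P.cNum ++ P.cDen, 0 < r.2
  D_pos : ∀ r ∈ P.dNum ++ P.dDen, 0 < r.2
  c_lt : ∀ r ∈ P.cNum, r.1 + r.2 < 1
  d_lt : ∀ r ∈ P.dNum, -(r.1 / r.2) < 1
  exists_contour : ∃ σ : ℝ, P.IsContour σ

end FoxHParam

/-- The parameters `(a_j; A_j^{(1)}, …, A_j^{(N)})` and `(b_j; B_j^{(1)}, …, B_j^{(N)})` of a Fox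
H-function of `N` variables of the form `H^{0,n₀}_{p₀,q₀}`. -/
structure MultiFoxHParam (N : ℕ) where
  /-- `(a_j; A_j)` for `1 ≤ j ≤ n₀` -/
  aNum : List (ℝ × (Fin N → ℝ))
  /-- `(a_j; A_j)` for `n₀ < j ≤ p₀` -/
  aDen : List (ℝ × (Fin N → ℝ))
  /-- `(b_j; B_j)` for `1 ≤ j ≤ q₀` -/
  b : List (ℝ × (Fin N → ℝ))

namespace MultiFoxHParam

variable {N : ℕ}

/-- The kernel `Ψ(ζ) = ∏_{j≤n₀} Γ(1 - a_j + ∑_l A_j^{(l)} ζ_l) /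
  (∏_{j>n₀} Γ(a_j - ∑_l A_j^{(l)} ζ_l) ∏_{j≤q₀} Γ(1 - b_j + ∑_l B_j^{(l)} ζ_l))`. -/
noncomputable def psi (Q : MultiFoxHParam N) (ζ : Fin N → ℂ) : ℂ :=
  (Q.aNum.map fun r => Complex.Gamma (1 - (r.1 : ℂ) + ∑ l, (r.2 l : ℂ) * ζ l)).prod /
    ((Q.aDen.map fun r => Complex.Gamma ((r.1 : ℂ) - ∑ l, (r.2 l : ℂ) * ζ l)).prod *
      (Q.b.map fun r => Complex.Gamma (1 - (r.1 : ℂ) + ∑ l, (r.2 l : ℂ) * ζ l)).prod)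

/-- The point `ζ_j = σ_j + i y_j`, `1 ≤ j ≤ N`, of the product of the lines `Re ζ_j = σ_j`. -/
noncomputable def linePoint (σ y : Fin N → ℝ) : Fin N → ℂ :=
  fun j => (σ j : ℂ) + (y j : ℂ) * Complex.I

/-- The lines `Re ζ_j = σ_j` are suitable contours: they separate the poles of the Gamma factors of
the numerator and the multiple integral along them converges absolutely (for positive `v_j s_j`
the factors `(v_j s_j)^{ζ_j}` have constant modulus). -/
def IsContour (Q : MultiFoxHParam N) (P : Fin N → FoxHParam) (σ : Fin N → ℝ) : Prop :=
  (∀ j, (P j).Separates (σ j)) ∧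
  (∀ r ∈ Q.aNum, 0 < 1 - r.1 + ∑ l, r.2 l * σ l) ∧
  Integrable (fun y : Fin N → ℝ =>
    Q.psi (linePoint σ y) * ∏ j, (P j).kernel (linePoint σ y j))

/-- Abscissae of suitable contours (arbitrary if there are none). -/
noncomputable def contour (Q : MultiFoxHParam N) (P : Fin N → FoxHParam) : Fin N → ℝ :=
  Classical.epsilon (Q.IsContour P)

/-- The Fox H-function of `N` variables
`H^{0,n₀}_{p₀,q₀}[(a; A), (b; B) : (s_j, O_j, P_j)_{1,N}]
  = u₁⋯u_N / (2πi)^N ∫_{L₁} ⋯ ∫_{L_N} Ψ(ζ) ∏_j Φ_j(ζ_j) (v_j s_j)^{ζ_j} dζ₁ ⋯ dζ_N`,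
for `s_j > 0`; on the lines one has `dζ_j = i dy_j`. -/
noncomputable def foxH (Q : MultiFoxHParam N) (s : Fin N → ℝ) (P : Fin N → FoxHParam) : ℂ :=
  ((∏ j, ((P j).u : ℂ)) / (2 * (Real.pi : ℂ)) ^ N) *
    ∫ y : Fin N → ℝ, Q.psi (linePoint (Q.contour P) y) *
      ∏ j, ((P j).kernel (linePoint (Q.contour P) y j) *
        (((P j).v * s j : ℝ) : ℂ) ^ (linePoint (Q.contour P) y j))

/-- The parameters of `H^{0,1}_{1,0}` with upper entry `(1 - A; 1, …, 1)` and no lower entry. -/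
def effRate (N : ℕ) (A : ℝ) : MultiFoxHParam N where
  aNum := [(1 - A, fun _ => 1)]
  aDen := []
  b := []

end MultiFoxHParam

/-- The random variable `X` follows hyper Fox H fading with `K` components: it has on `(0, ∞)` the
density `f(x) = ∑_k H[x, O_k, P_k] ≥ 0`. -/
structure IsHyperFoxHFading {Ω : Type*} [MeasurableSpace Ω] (μ : Measure Ω) (X : Ω → ℝ)
    {K : ℕ} (P : Fin K → FoxHParam) : Prop where
  measurable : Measurable X
  component : ∀ k, (P k).IsDensityComponent
  law : ∃ f : ℝ → ℝ,
    (∀ x, 0 < x → 0 ≤ f x ∧ (f x : ℂ) = ∑ k, (P k).foxH x) ∧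
    μ.map X = (volume.restrict (Set.Ioi 0)).withDensity fun x => ENNReal.ofReal (f x)

/-- `A = θ T B / ln 2`, for the QoS exponent `θ`, block duration `T` and bandwidth `B`. -/
noncomputable def effRateExponent (θ T B : ℝ) : ℝ := θ * T * B / Real.log 2

/-- The effective rate `R(θ) = -(1/A) log₂ E[(1 + (ρ/N) ∑_j γ_j)^{-A}]` of a MISO channel with `N`
transmit antennas, channel power gains `γ_j` and average transmit SNR `ρ`. -/
noncomputable def effectiveRate {Ω : Type*} [MeasurableSpace Ω] (μ : Measure Ω) {N : ℕ}
    (γ : Fin N → Ω → ℝ) (ρ θ T B : ℝ) : ℝ :=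
  -(1 / effRateExponent θ T B) *
    Real.logb 2 (∫ ω, (1 + ρ / (N : ℝ) * ∑ j, γ j ω) ^ (-effRateExponent θ T B) ∂μ)

/-! By Euler's integral, `Γ(A) (1 + aS)^(-A) = ∫ t^(A-1) e^(-t) e^(-atS) dt` over `t > 0`. For `S`
the sum of the independent gains, the expectation of the last factor is the product of the moment
generating functions at `at`. If each of these is a finite sum of H-functions, the product expands
into the multiple sum, and in every term the `t`-integral of `t^(A-1+∑ζ_l) e^(-t)` produces the
factor `Γ(A + ∑ζ_l)` of the multivariate function (`integral_one_add_rpow_mul_Gamma`,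
`foxH_effRate_eq`).

The work lies in the moment generating functions. Formally, integrating `x^z e^(-sx)` under the
Mellin-Barnes integral gives `Γ(z+1) s^(-z-1)`, and the substitution `w = -1 - z` is the Mellin
operation. This interchange needs a contour with `Re z > -1`, while that of the density may lie
further left. The parameter conditions say that the line `Re z = -1` separates the poles, but not
that the integral of the density converges absolutely on lines near it. For `x^n e^(-sx)` with `n`
large, however, the interchange is legitimate on the given contour; the resulting integrand contains
`Γ(z+n+1)`, decays exponentially, and its contour can be moved to `Re z > -1`. Integrating both
sides over `(s, ∞)` lowers `n` by one, down to `n = 0` (`integral_pow_mul_exp_eq`). This descent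
concerns the whole law, so the components need not be integrable against `e^(-sx)` one by one.

The decay rests on a two-sided estimate: `|Γ(x+iy)|` is `e^(-π|y|/2)` up to powers of `|y|`,
uniformly on strips. Hence a kernel has one exponential rate on all vertical lines; integrability on
a single line makes it nonpositive, and the additional Gamma factor makes it negative. -/

/-! ### Exponential rates on vertical strips -/

/-- On the strip `a ≤ Re z ≤ b`, away from the real axis, the modulus of `g` is `e^{α |Im z|}` up to
a factor of at most polynomial size. -/
def VerticalGrowth (a b α : ℝ) (g : ℂ → ℂ) : Prop :=
  ∃ C : ℝ, 0 < C ∧ ∃ M : ℕ, ∃ Y : ℝ, 1 ≤ Y ∧ ∀ z : ℂ, a ≤ z.re → z.re ≤ b → Y ≤ |z.im| →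
    ‖g z‖ ≤ C * |z.im| ^ M * Real.exp (α * |z.im|) ∧
      Real.exp (α * |z.im|) ≤ C * |z.im| ^ M * ‖g z‖

namespace VerticalGrowth

variable {a b a' b' α β : ℝ} {g h : ℂ → ℂ}

theorem mono (hg : VerticalGrowth a b α g) (ha : a ≤ a') (hb : b' ≤ b) :
    VerticalGrowth a' b' α g := by
  obtain ⟨C, hC, M, Y, hY, H⟩ := hg
  exact ⟨C, hC, M, Y, hY, fun z h1 h2 h3 => H z (ha.trans h1) (h2.trans hb) h3⟩

theorem mul (hg : VerticalGrowth a b α g) (hh : VerticalGrowth a b β h) :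
    VerticalGrowth a b (α + β) (fun z => g z * h z) := by
  obtain ⟨C, hC, M, Y, hY, H⟩ := hg
  obtain ⟨C', hC', M', Y', hY', H'⟩ := hh
  refine ⟨C * C', by positivity, M + M', max Y Y', hY.trans (le_max_left _ _),
    fun z h1 h2 h3 => ?_⟩
  obtain ⟨p, q⟩ := H z h1 h2 ((le_max_left _ _).trans h3)
  obtain ⟨p', q'⟩ := H' z h1 h2 ((le_max_right _ _).trans h3)
  rw [add_mul, Real.exp_add, norm_mul, pow_add]
  constructor
  · calc _ ≤ _ := mul_le_mul p p' (norm_nonneg _) (by positivity)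
      _ = _ := by ring
  · calc _ ≤ _ := mul_le_mul q q' (Real.exp_nonneg _) (by positivity)
      _ = _ := by ring

/-- The upper and lower bounds exchange roles. Gamma factors in denominators are one reason to ask
for both. -/
theorem inv (hg : VerticalGrowth a b α g) : VerticalGrowth a b (-α) (fun z => (g z)⁻¹) := by
  obtain ⟨C, hC, M, Y, hY, H⟩ := hg
  refine ⟨C, hC, M, Y, hY, fun z h1 h2 h3 => ?_⟩
  obtain ⟨p, q⟩ := H z h1 h2 h3
  have hy : 0 < |z.im| := by linarith
  have hg0 : 0 < ‖g z‖ := by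
    by_contra h0
    have : ‖g z‖ = 0 := le_antisymm (not_lt.mp h0) (norm_nonneg _)
    rw [this, mul_zero] at q
    exact absurd q (not_le.mpr (Real.exp_pos _))
  have he := Real.exp_pos (α * |z.im|)
  rw [neg_mul, Real.exp_neg, norm_inv]
  constructor
  · rw [inv_le_iff_one_le_mul₀ hg0, ← div_eq_mul_inv, div_mul_eq_mul_div, le_div_iff₀ he]
    linarith
  · rw [inv_le_iff_one_le_mul₀ he, ← div_eq_mul_inv, div_mul_eq_mul_div, le_div_iff₀ hg0]
    linarith

theorem of_le_of_le {c C : ℝ} (hc : 0 < c) (h1 : ∀ z : ℂ, a ≤ z.re → z.re ≤ b → ‖g z‖ ≤ C)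
    (h2 : ∀ z : ℂ, a ≤ z.re → z.re ≤ b → c ≤ ‖g z‖) : VerticalGrowth a b 0 g := by
  refine ⟨max C c⁻¹, lt_max_of_lt_right (inv_pos.mpr hc), 0, 1, le_rfl, fun z ha hb _ => ?_⟩
  simp only [pow_zero, mul_one, zero_mul, Real.exp_zero]
  refine ⟨(h1 z ha hb).trans (le_max_left _ _), ?_⟩
  calc (1 : ℝ) = c⁻¹ * c := (inv_mul_cancel₀ hc.ne').symm
    _ ≤ _ := mul_le_mul (le_max_right _ _) (h2 z ha hb) hc.le
      (le_max_of_le_right (inv_pos.mpr hc).le)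

theorem one : VerticalGrowth a b 0 (fun _ => 1) :=
  of_le_of_le (c := 1) (C := 1) one_pos (by simp) (by simp)

theorem const_cpow {c : ℝ} (hc : 0 < c) : VerticalGrowth a b 0 (fun z => (c : ℂ) ^ z) := by
  have key : ∀ z : ℂ, ‖(c : ℂ) ^ z‖ = c ^ z.re := fun z => Complex.norm_cpow_eq_rpow_re_of_pos hc z
  have hcont : ContinuousOn (fun x : ℝ => c ^ x) (Set.Icc a b) :=
    (Real.continuous_const_rpow hc.ne').continuousOn
  rcases le_or_gt a b with hab | hab
  · obtain ⟨x, _, hx⟩ := isCompact_Icc.exists_isMinOn (Set.nonempty_Icc.mpr hab) hcont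
    obtain ⟨x', _, hx'⟩ := isCompact_Icc.exists_isMaxOn (Set.nonempty_Icc.mpr hab) hcont
    refine of_le_of_le (c := c ^ x) (C := c ^ x') (by positivity) ?_ ?_
    · intro z h1 h2
      rw [key]
      exact hx' ⟨h1, h2⟩
    · intro z h1 h2
      rw [key]
      exact hx ⟨h1, h2⟩
  · exact of_le_of_le (c := 1) (C := 1) one_pos (fun z h1 h2 => by linarith)
      (fun z h1 h2 => by linarith)

theorem list_prod {ι : Type*} (l : List ι) (f : ι → ℂ → ℂ) (r : ι → ℝ)
    (H : ∀ i ∈ l, VerticalGrowth a b (r i) (f i)) :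
    VerticalGrowth a b (l.map r).sum (fun z => (l.map fun i => f i z).prod) := by
  induction l with
  | nil => simpa using one
  | cons i l ih =>
    simp only [List.map_cons, List.prod_cons, List.sum_cons]
    exact (H i (by simp)).mul (ih fun j hj => H j (by simp [hj]))

theorem comp_affine (hg : ∀ a b, VerticalGrowth a b α g) (e : ℝ) {d : ℝ} (hd : d ≠ 0) :
    VerticalGrowth a b (α * |d|) (fun z => g (e + d * z)) := by
  -- This strip contains the image of `[a, b]` for either sign of `d`.
  obtain ⟨C, hC, M, Y, hY, H⟩ := hg (e - |d| * (|a| + |b|)) (e + |d| * (|a| + |b|))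
  have hd' := abs_pos.mpr hd
  refine ⟨C * (1 + |d|) ^ M, by positivity, M, max 1 (Y / |d|), le_max_left _ _,
    fun z h1 h2 h3 => ?_⟩
  have him : ((e : ℂ) + d * z).im = d * z.im := by simp
  have hre : ((e : ℂ) + d * z).re = e + d * z.re := by simp
  have hz : |z.re| ≤ |a| + |b| := by
    rw [abs_le]
    constructor <;> linarith [neg_abs_le a, le_abs_self b, abs_nonneg a, abs_nonneg b]
  have hdz : |d * z.re| ≤ |d| * (|a| + |b|) := by
    rw [abs_mul]
    gcongr
  rw [abs_le] at hdz
  have hY' : Y ≤ |d| * |z.im| := by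
    have := (le_max_right 1 (Y / |d|)).trans h3
    rw [div_le_iff₀ hd'] at this
    linarith
  have := H ((e : ℂ) + d * z) (by rw [hre]; linarith) (by rw [hre]; linarith)
    (by rw [him, abs_mul]; exact hY')
  rw [him, abs_mul] at this
  have hexp : α * |d| * |z.im| = α * (|d| * |z.im|) := by ring
  have hle : C * (|d| * |z.im|) ^ M ≤ C * (1 + |d|) ^ M * |z.im| ^ M := by
    rw [mul_assoc, ← mul_pow]
    gcongr
    linarith
  rw [hexp]
  exact ⟨this.1.trans (mul_le_mul_of_nonneg_right hle (Real.exp_nonneg _)),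
    this.2.trans (mul_le_mul_of_nonneg_right hle (norm_nonneg _))⟩

/-- The bounds are required only for `|Im z| ≥ Y ≥ 1`, so the real axis, with the poles of Gamma, is
irrelevant. -/
theorem congr (hg : VerticalGrowth a b α g) (H : ∀ z : ℂ, z.im ≠ 0 → g z = h z) :
    VerticalGrowth a b α h := by
  obtain ⟨C, hC, M, Y, hY, H'⟩ := hg
  refine ⟨C, hC, M, Y, hY, fun z h1 h2 h3 => ?_⟩
  rw [← H z (fun h0 => by rw [h0, abs_zero] at h3; linarith)]
  exact H' z h1 h2 h3

theorem linear (e : ℝ) : VerticalGrowth a b 0 (fun z => z + e) := by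
  refine ⟨1 + |e| + (|a| + |b|), by positivity, 1, 1, le_rfl, fun z h1 h2 h3 => ?_⟩
  have hz : |z.re| ≤ |a| + |b| := by
    rw [abs_le]
    constructor <;> linarith [neg_abs_le a, le_abs_self b, abs_nonneg a, abs_nonneg b]
  simp only [pow_one, zero_mul, Real.exp_zero, mul_one]
  constructor
  · calc ‖z + e‖ ≤ ‖z‖ + ‖(e : ℂ)‖ := norm_add_le _ _
      _ ≤ (|z.re| + |z.im|) + |e| := by
          rw [Complex.norm_real, Real.norm_eq_abs]
          gcongr
          exact Complex.norm_le_abs_re_add_abs_im z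
      _ ≤ (|e| + (|a| + |b|)) * 1 + |z.im| := by linarith
      _ ≤ (|e| + (|a| + |b|)) * |z.im| + |z.im| := by gcongr
      _ = _ := by ring
  · have h4 : |z.im| ≤ ‖z + e‖ := by simpa using Complex.abs_im_le_norm (z + e)
    calc (1 : ℝ) = 1 * 1 * 1 := by norm_num
      _ ≤ (1 + |e| + (|a| + |b|)) * |z.im| * ‖z + e‖ := by
        gcongr
        · linarith [abs_nonneg e, abs_nonneg a, abs_nonneg b]
        · linarith

theorem comp_add (hg : VerticalGrowth (a + a') (b + a') α g) :
    VerticalGrowth a b α (fun z => g (z + a')) := by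
  obtain ⟨C, hC, M, Y, hY, H⟩ := hg
  refine ⟨C, hC, M, Y, hY, fun z h1 h2 h3 => ?_⟩
  have := H (z + a') (by simpa using h1) (by simpa using h2) (by simpa using h3)
  simpa using this

/-- A function with exponential growth on a line is not integrable there. -/
theorem nonpos_of_integrable (hg : VerticalGrowth a b α g) {σ : ℝ} (ha : a ≤ σ) (hb : σ ≤ b)
    (hi : Integrable (fun y : ℝ => g ((σ : ℂ) + (y : ℂ) * Complex.I))) : α ≤ 0 := by
  by_contra! hα
  obtain ⟨C, hC, M, Y, hY, H⟩ := hg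
  -- A positive rate beats `y ^ M`, so the lower bound keeps the modulus above `1` on a half-line of
  -- infinite measure.
  have h1 : ∀ᶠ y : ℝ in Filter.atTop, 1 ≤ ‖g ((σ : ℂ) + (y : ℂ) * Complex.I)‖ := by
    have := (isLittleO_pow_exp_pos_mul_atTop M hα).def (inv_pos.mpr hC)
    filter_upwards [this, Filter.eventually_ge_atTop Y] with y hy hyY
    have hy0 : 0 < y := by linarith
    have := (H ((σ : ℂ) + (y : ℂ) * Complex.I) (by simpa using ha) (by simpa using hb)
      (by simpa [abs_of_pos hy0] using hyY)).2
    simp only [Complex.add_im, Complex.ofReal_im, Complex.mul_im, Complex.ofReal_re, Complex.I_im,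
      mul_one, Complex.I_re, mul_zero, add_zero, zero_add, abs_of_pos hy0] at this
    rw [Real.norm_of_nonneg (by positivity), Real.norm_of_nonneg (by positivity),
      ← div_eq_inv_mul, le_div_iff₀ hC] at hy
    have h3 : 0 < C * y ^ M := by positivity
    nlinarith
  obtain ⟨T, hT⟩ := Filter.eventually_atTop.mp h1
  have h2 : IntegrableOn (fun _ : ℝ => (1 : ℝ)) (Set.Ioi T) := by
    refine Integrable.mono' hi.norm.integrableOn aestronglyMeasurable_const ?_
    refine (ae_restrict_iff' measurableSet_Ioi).mpr (Filter.Eventually.of_forall fun y hy => ?_)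
    simpa using hT y (le_of_lt hy)
  rw [integrableOn_const_iff] at h2
  simp at h2

/-- Exponential decay on a strip, with continuity, gives quadratic decay on the whole strip. -/
theorem exists_norm_le (hg : VerticalGrowth a b α g) (hα : α < 0)
    (hc : ∀ z : ℂ, a ≤ z.re → z.re ≤ b → ContinuousAt g z) :
    ∃ C : ℝ, 0 ≤ C ∧ ∀ z : ℂ, a ≤ z.re → z.re ≤ b → ‖g z‖ ≤ C * (1 + z.im ^ 2)⁻¹ := by
  obtain ⟨C, hC, M, Y, hY, H⟩ := hg
  -- The two extra powers pay for the factor `1 + z.im ^ 2`.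
  have h1 := ((isLittleO_pow_exp_pos_mul_atTop (M + 2) (neg_pos.mpr hα)).def one_pos)
  obtain ⟨T, hT⟩ := Filter.eventually_atTop.mp h1
  set R := max T Y with hR
  have hR0 : 1 ≤ R := hY.trans (le_max_right _ _)
  have hcomp : IsCompact (Set.Icc a b ×ℂ Set.Icc (-R) R) := isCompact_Icc.reProdIm isCompact_Icc
  have hcont : ContinuousOn g (Set.Icc a b ×ℂ Set.Icc (-R) R) := fun z hz =>
    (hc z hz.1.1 hz.1.2).continuousWithinAt
  obtain ⟨D, hD⟩ := hcomp.exists_bound_of_continuousOn hcont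
  -- The first constant serves `|Im z| > R`, the second the compact rectangle `|Im z| ≤ R`.
  refine ⟨max (2 * C) (|D| * (1 + R ^ 2)), le_max_of_le_left (by positivity), fun z h1 h2 => ?_⟩
  rw [← div_eq_mul_inv, le_div_iff₀ (by positivity)]
  rcases le_or_gt |z.im| R with h | h
  · refine le_trans ?_ (le_max_right _ _)
    have h3 := hD z ⟨⟨h1, h2⟩, abs_le.mp h⟩
    have h4 : z.im ^ 2 ≤ R ^ 2 := sq_le_sq' (abs_le.mp h).1 (abs_le.mp h).2
    gcongr
    exact h3.trans (le_abs_self D)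
  · refine le_trans ?_ (le_max_left _ _)
    have h3 := (H z h1 h2 ((le_max_right _ _).trans h.le)).1
    have h4 := hT |z.im| ((le_max_left _ _).trans h.le)
    have hy : 1 < |z.im| := by linarith
    rw [Real.norm_of_nonneg (by positivity), Real.norm_of_nonneg (by positivity), one_mul,
      neg_mul, Real.exp_neg, ← one_div, le_div_iff₀ (Real.exp_pos _)] at h4
    have h5 : 1 + z.im ^ 2 ≤ 2 * |z.im| ^ 2 := by
      rw [sq_abs]
      nlinarith [sq_abs z.im]
    calc ‖g z‖ * (1 + z.im ^ 2)
        ≤ (C * |z.im| ^ M * Real.exp (α * |z.im|)) * (2 * |z.im| ^ 2) := by gcongr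
      _ = 2 * C * (|z.im| ^ (M + 2) * Real.exp (α * |z.im|)) := by ring
      _ ≤ 2 * C * 1 := by gcongr
      _ = 2 * C := mul_one _

end VerticalGrowth

/-! ### Two-sided growth of the Gamma function -/

namespace Complex

/-- `|Γ(x + iy)| / Γ(x)` increases with `x > 0`. -/
theorem norm_Gamma_mul_le {z w : ℂ} (him : z.im = w.im) (hz : 0 < z.re) (hzw : z.re ≤ w.re) :
    ‖Gamma z‖ * Real.Gamma w.re ≤ ‖Gamma w‖ * Real.Gamma z.re := by
  -- The inequality is proved for Euler's approximating products and passed to the limit.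
  refine le_of_tendsto_of_tendsto'
    ((GammaSeq_tendsto_Gamma z).norm.mul (Real.GammaSeq_tendsto_Gamma w.re))
    ((GammaSeq_tendsto_Gamma w).norm.mul (Real.GammaSeq_tendsto_Gamma z.re)) fun n => ?_
  rcases Nat.eq_zero_or_pos n with rfl | hn
  · have hz0 : z ≠ 0 := fun h => by simp [h] at hz
    have hw : 0 < w.re := hz.trans_le hzw
    have hw0 : w ≠ 0 := fun h => by simp [h] at hw
    simp [GammaSeq, Real.GammaSeq, hz0, hw0, hz.ne', hw.ne']
  · simp only [GammaSeq, Real.GammaSeq, norm_div, norm_mul, norm_prod,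
      norm_natCast_cpow_of_pos hn, norm_natCast]
    have hw : 0 < w.re := hz.trans_le hzw
    have pos : ∀ s : ℂ, 0 < s.re → ∀ j : ℕ, 0 < ‖s + j‖ := fun s hs j => by
      rw [norm_pos_iff]
      intro h
      have := congrArg re h
      simp at this
      linarith [(Nat.cast_nonneg j : (0 : ℝ) ≤ j)]
    have p1 : 0 < ∏ j ∈ Finset.range (n + 1), ‖z + j‖ := Finset.prod_pos fun j _ => pos z hz j
    have p2 : 0 < ∏ j ∈ Finset.range (n + 1), ‖w + j‖ := Finset.prod_pos fun j _ => pos w hw j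
    have p3 : 0 < ∏ j ∈ Finset.range (n + 1), (z.re + j) :=
      Finset.prod_pos fun j _ => by positivity
    have p4 : 0 < ∏ j ∈ Finset.range (n + 1), (w.re + j) :=
      Finset.prod_pos fun j _ => by positivity
    rw [div_mul_div_comm, div_mul_div_comm]
    have hnum : (n : ℝ) ^ z.re * n.factorial * ((n : ℝ) ^ w.re * n.factorial) =
      (n : ℝ) ^ w.re * n.factorial * ((n : ℝ) ^ z.re * n.factorial) := by ring
    rw [hnum]
    refine div_le_div_of_nonneg_left (by positivity) (by positivity) ?_
    rw [← Finset.prod_mul_distrib, ← Finset.prod_mul_distrib]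
    -- Factor by factor, with `y` the common imaginary part: `|x+j+iy|² / (x+j)² = 1 + y² / (x+j)²`
    -- decreases in `x`.
    refine Finset.prod_le_prod (fun j _ => by positivity) fun j _ => ?_
    refine le_of_sq_le_sq ?_ (by positivity)
    rw [mul_pow, mul_pow, Complex.sq_norm, Complex.sq_norm, normSq_apply, normSq_apply]
    simp only [add_re, natCast_re, add_im, natCast_im, add_zero, him]
    have h1 : z.re + j ≤ w.re + j := by linarith
    have h2 : 0 < z.re + j := by positivity
    nlinarith [mul_le_mul h1 h1 h2.le (by linarith), sq_nonneg w.im]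

/-- On this line `1 - z` is the conjugate of `z`, so the reflection formula computes the modulus
exactly. -/
theorem norm_Gamma_half_sq (z : ℂ) (hz : z.re = 1 / 2) :
    ‖Gamma z‖ ^ 2 = Real.pi / Real.cosh (Real.pi * z.im) := by
  have h1 : 1 - z = (starRingEnd ℂ) z := by
    apply Complex.ext <;> simp [hz]
    norm_num
  have h2 := Gamma_mul_Gamma_one_sub z
  rw [h1, Gamma_conj, mul_conj, normSq_eq_norm_sq] at h2
  have h3 : sin (Real.pi * z) = ((Real.cosh (Real.pi * z.im) : ℝ) : ℂ) := by
    have : (Real.pi : ℂ) * z = ((Real.pi * z.im : ℝ) : ℂ) * I + Real.pi / 2 := by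
      apply Complex.ext <;> simp [hz]
      · ring
    rw [this, sin_add_pi_div_two, cos_mul_I, ofReal_cosh]
  rw [h3] at h2
  exact_mod_cast h2

theorem verticalGrowth_Gamma_half :
    VerticalGrowth (1 / 2) (1 / 2) (-(Real.pi / 2)) Gamma := by
  -- With `E = e^(-π|y|/2)`, `cosh(πy) E²` lies in `[1/2, 1]`; as `π ≤ 9/2`, the squared constant
  -- `9` suffices in both directions.
  refine ⟨3, by norm_num, 0, 1, le_rfl, fun z h1 h2 _ => ?_⟩
  have h := norm_Gamma_half_sq z (le_antisymm h2 h1)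
  have hpi := Real.pi_gt_three
  have hpi4 := Real.pi_le_four
  set E := Real.exp (-(Real.pi / 2) * |z.im|) with hE
  have hE0 : 0 < E := Real.exp_pos _
  have hE2 : E ^ 2 = Real.exp (-(Real.pi * |z.im|)) := by
    rw [hE, ← Real.exp_nat_mul]
    congr 1
    push_cast
    ring
  have hch : Real.cosh (Real.pi * z.im) = Real.cosh (Real.pi * |z.im|) := by
    rw [← Real.cosh_abs (Real.pi * z.im), abs_mul, abs_of_pos Real.pi_pos]
  have hEi : Real.exp (Real.pi * |z.im|) * E ^ 2 = 1 := by
    rw [hE2, ← Real.exp_add]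
    simp
  have hle : Real.exp (-(Real.pi * |z.im|)) ≤ Real.exp (Real.pi * |z.im|) := by
    apply Real.exp_le_exp.mpr
    have : 0 ≤ Real.pi * |z.im| := by positivity
    linarith
  have hcosh := Real.cosh_eq (Real.pi * |z.im|)
  have hc0 := Real.cosh_pos (Real.pi * |z.im|)
  rw [hch, eq_div_iff hc0.ne'] at h
  have hep := Real.exp_pos (-(Real.pi * |z.im|))
  simp only [pow_zero, mul_one]
  set c := Real.cosh (Real.pi * |z.im|)
  have hcE1 : c * E ^ 2 ≤ 1 := by nlinarith [sq_nonneg E]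
  have hcE2 : 1 ≤ 2 * (c * E ^ 2) := by nlinarith [sq_nonneg E]
  constructor
  · refine le_of_sq_le_sq ?_ (by positivity)
    rw [← mul_le_mul_iff_left₀ hc0, h]
    nlinarith
  · refine le_of_sq_le_sq ?_ (by positivity)
    rw [← mul_le_mul_iff_left₀ hc0, mul_pow, mul_assoc, h]
    nlinarith

theorem verticalGrowth_Gamma_add_one {a b : ℝ}
    (h : VerticalGrowth a b (-(Real.pi / 2)) Gamma) :
    VerticalGrowth (a + 1) (b + 1) (-(Real.pi / 2)) Gamma := by
  have h1 : VerticalGrowth (a + 1) (b + 1) (-(Real.pi / 2)) (fun z => Gamma (z + (-1 : ℝ))) :=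
    VerticalGrowth.comp_add (by simpa using h)
  have h2 := (VerticalGrowth.linear (a := a + 1) (b := b + 1) (-1)).mul h1
  rw [zero_add] at h2
  refine h2.congr fun z hz => ?_
  have h0 : z + ((-1 : ℝ) : ℂ) ≠ 0 := fun h => hz (by simpa using congrArg im h)
  rw [← Gamma_add_one _ h0]
  simp

theorem verticalGrowth_Gamma_sub_one {a b : ℝ}
    (h : VerticalGrowth (a + 1) (b + 1) (-(Real.pi / 2)) Gamma) :
    VerticalGrowth a b (-(Real.pi / 2)) Gamma := by
  have h1 : VerticalGrowth a b (-(Real.pi / 2)) (fun z => Gamma (z + (1 : ℝ))) :=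
    VerticalGrowth.comp_add h
  have h2 := (VerticalGrowth.linear (a := a) (b := b) 0).inv.mul h1
  rw [neg_zero, zero_add] at h2
  refine h2.congr fun z hz => ?_
  have h0 : z ≠ 0 := fun h => hz (by simp [h])
  simp only [ofReal_zero, add_zero, ofReal_one]
  rw [Gamma_add_one _ h0, inv_mul_cancel_left₀ h0]

/-- Since `|Γ(x+iy)| / Γ(x)` increases in `x`, the left edge gives the lower bound and the right
edge the upper one; `k` absorbs the variation of the real Gamma function on `[a, b]`. -/
theorem verticalGrowth_Gamma_of_pos {a b : ℝ} (ha : 0 < a) (hab : a ≤ b)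
    (h1 : VerticalGrowth a a (-(Real.pi / 2)) Gamma)
    (h2 : VerticalGrowth b b (-(Real.pi / 2)) Gamma) :
    VerticalGrowth a b (-(Real.pi / 2)) Gamma := by
  have hcont : ContinuousOn Real.Gamma (Set.Icc a b) := fun x hx =>
    (Real.differentiableAt_Gamma fun m h => by
      linarith [hx.1, (Nat.cast_nonneg m : (0 : ℝ) ≤ m)]).continuousAt.continuousWithinAt
  obtain ⟨u, hu, hmin⟩ := isCompact_Icc.exists_isMinOn (Set.nonempty_Icc.mpr hab) hcont
  obtain ⟨v, hv, hmax⟩ := isCompact_Icc.exists_isMaxOn (Set.nonempty_Icc.mpr hab) hcont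
  have hu0 := Real.Gamma_pos_of_pos (ha.trans_le hu.1)
  have hv0 := Real.Gamma_pos_of_pos (ha.trans_le hv.1)
  set k := Real.Gamma v / Real.Gamma u with hk
  have hk0 : 0 < k := by positivity
  obtain ⟨C, hC, M, Y, hY, H⟩ := h1
  obtain ⟨C', hC', M', Y', hY', H'⟩ := h2
  refine ⟨k * (C + C'), by positivity, M + M', max Y Y', hY.trans (le_max_left _ _),
    fun z hza hzb hz => ?_⟩
  have hz1 : 1 ≤ |z.im| := (hY.trans (le_max_left _ _)).trans hz
  have e1 := (H ⟨a, z.im⟩ le_rfl le_rfl ((le_max_left _ _).trans hz)).2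
  have e2 := (H' ⟨b, z.im⟩ le_rfl le_rfl ((le_max_right _ _).trans hz)).1
  have m1 := norm_Gamma_mul_le (z := ⟨a, z.im⟩) (w := z) rfl ha hza
  have m2 := norm_Gamma_mul_le (z := z) (w := ⟨b, z.im⟩) rfl (ha.trans_le hza) hzb
  simp only at e1 e2 m1 m2
  have gz1 : Real.Gamma u ≤ Real.Gamma z.re := hmin ⟨hza, hzb⟩
  have gz2 : Real.Gamma z.re ≤ Real.Gamma v := hmax ⟨hza, hzb⟩
  have ga : Real.Gamma a ≤ Real.Gamma v := hmax ⟨le_rfl, hab⟩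
  have gb : Real.Gamma u ≤ Real.Gamma b := hmin ⟨hab, le_rfl⟩
  have n1 : ‖Gamma ⟨a, z.im⟩‖ ≤ k * ‖Gamma z‖ := by
    rw [hk, div_mul_eq_mul_div, le_div_iff₀ hu0]
    calc _ ≤ ‖Gamma ⟨a, z.im⟩‖ * Real.Gamma z.re := by gcongr
      _ ≤ ‖Gamma z‖ * Real.Gamma a := m1
      _ ≤ ‖Gamma z‖ * Real.Gamma v := by gcongr
      _ = _ := mul_comm _ _
  have n2 : ‖Gamma z‖ ≤ k * ‖Gamma ⟨b, z.im⟩‖ := by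
    rw [hk, div_mul_eq_mul_div, le_div_iff₀ hu0]
    calc _ ≤ ‖Gamma z‖ * Real.Gamma b := by gcongr
      _ ≤ ‖Gamma ⟨b, z.im⟩‖ * Real.Gamma z.re := m2
      _ ≤ ‖Gamma ⟨b, z.im⟩‖ * Real.Gamma v := by gcongr
      _ = _ := mul_comm _ _
  constructor
  · calc ‖Gamma z‖ ≤ k * (C' * |z.im| ^ M' * Real.exp (-(Real.pi / 2) * |z.im|)) :=
          n2.trans (by gcongr)
      _ ≤ k * ((C + C') * |z.im| ^ (M + M') * Real.exp (-(Real.pi / 2) * |z.im|)) := by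
          gcongr
          · linarith
          · omega
      _ = _ := by ring
  · calc _ ≤ C * |z.im| ^ M * (k * ‖Gamma z‖) := e1.trans (by gcongr)
      _ ≤ (C + C') * |z.im| ^ (M + M') * (k * ‖Gamma z‖) := by
          gcongr
          · linarith
          · omega
      _ = _ := by ring

/-- The functional equation carries the estimate from `Re z = 1/2` to the lines `1/2 + n`,
interpolation fills the strips between, and the functional equation then extends them to the left.
-/
theorem verticalGrowth_Gamma (a b : ℝ) : VerticalGrowth a b (-(Real.pi / 2)) Gamma := by
  have up : ∀ n : ℕ, VerticalGrowth (1 / 2 + n) (1 / 2 + n) (-(Real.pi / 2)) Gamma := by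
    intro n
    induction n with
    | zero => simpa using verticalGrowth_Gamma_half
    | succ n ih =>
      have := verticalGrowth_Gamma_add_one ih
      push_cast
      rwa [← add_assoc]
  have down : ∀ m n : ℕ, VerticalGrowth (1 / 2 - m) (1 / 2 + n) (-(Real.pi / 2)) Gamma := by
    intro m
    induction m with
    | zero =>
      intro n
      have := verticalGrowth_Gamma_of_pos (by norm_num)
        (by linarith [(Nat.cast_nonneg n : (0 : ℝ) ≤ n)]) verticalGrowth_Gamma_half (up n)
      simpa using this
    | succ m ih =>
      intro n
      -- The strip moved right by one ends at `1/2 + (n + 1)`, which is why `n` is quantified inside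
      -- the induction.
      refine verticalGrowth_Gamma_sub_one ?_
      have := ih (n + 1)
      push_cast at this ⊢
      exact this.mono (by linarith) (by linarith)
  obtain ⟨m, hm⟩ := exists_nat_ge (1 / 2 - a)
  obtain ⟨n, hn⟩ := exists_nat_ge (b - 1 / 2)
  exact (down m n).mono (by linarith) (by linarith)

end Complex

/-! ### Integrals along vertical lines and contour shifts -/

theorem integrable_verticalLine_of_norm_le {a b C σ : ℝ} {g : ℂ → ℂ}
    (hc : ∀ z : ℂ, a ≤ z.re → z.re ≤ b → ContinuousAt g z)
    (hC : ∀ z : ℂ, a ≤ z.re → z.re ≤ b → ‖g z‖ ≤ C * (1 + z.im ^ 2)⁻¹) (ha : a ≤ σ) (hb : σ ≤ b) :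
    Integrable (fun y : ℝ => g ((σ : ℂ) + (y : ℂ) * Complex.I)) := by
  have hcont : Continuous (fun y : ℝ => g ((σ : ℂ) + (y : ℂ) * Complex.I)) := by
    rw [continuous_iff_continuousAt]
    intro y
    exact ContinuousAt.comp (f := fun y : ℝ => (σ : ℂ) + (y : ℂ) * Complex.I)
      (hc _ (by simpa using ha) (by simpa using hb)) (by fun_prop)
  refine Integrable.mono' (integrable_inv_one_add_sq.const_mul C) hcont.aestronglyMeasurable
    (Filter.Eventually.of_forall fun y => ?_)
  simpa using hC ((σ : ℂ) + (y : ℂ) * Complex.I) (by simpa using ha) (by simpa using hb)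

/-- Shift of a vertical contour across a strip of holomorphy with quadratic decay. -/
theorem integral_verticalLine_eq {a b C : ℝ} {g : ℂ → ℂ} (hab : a ≤ b)
    (hd : ∀ z : ℂ, a ≤ z.re → z.re ≤ b → DifferentiableAt ℂ g z)
    (hC : ∀ z : ℂ, a ≤ z.re → z.re ≤ b → ‖g z‖ ≤ C * (1 + z.im ^ 2)⁻¹) :
    ∫ y : ℝ, g ((a : ℂ) + (y : ℂ) * Complex.I) = ∫ y : ℝ, g ((b : ℂ) + (y : ℂ) * Complex.I) := by
  have hc : ∀ z : ℂ, a ≤ z.re → z.re ≤ b → ContinuousAt g z := fun z h1 h2 =>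
    (hd z h1 h2).continuousAt
  have lim : ∀ σ : ℝ, a ≤ σ → σ ≤ b → Filter.Tendsto
      (fun T : ℝ => ∫ y : ℝ in (-T)..T, g ((σ : ℂ) + (y : ℂ) * Complex.I)) Filter.atTop
      (nhds (∫ y : ℝ, g ((σ : ℂ) + (y : ℂ) * Complex.I))) := fun σ h1 h2 =>
    intervalIntegral_tendsto_integral (integrable_verticalLine_of_norm_le hc hC h1 h2)
      Filter.tendsto_neg_atTop_atBot Filter.tendsto_id
  -- The values `s = 1` and `s = -1` give the top and bottom sides of the rectangle.
  have horiz : ∀ s : ℝ, s ^ 2 = 1 → Filter.Tendsto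
      (fun T : ℝ => ∫ x : ℝ in a..b, g ((x : ℂ) + ((s * T : ℝ) : ℂ) * Complex.I)) Filter.atTop
      (nhds 0) := by
    intro s hs
    have h0 : Filter.Tendsto (fun T : ℝ => C * (1 + T ^ 2)⁻¹ * |b - a|) Filter.atTop (nhds 0) := by
      have : Filter.Tendsto (fun T : ℝ => 1 + T ^ 2) Filter.atTop Filter.atTop :=
        Filter.tendsto_atTop_add_const_left _ _ (Filter.tendsto_pow_atTop two_ne_zero)
      simpa using (this.inv_tendsto_atTop.const_mul C).mul_const |b - a|
    refine squeeze_zero_norm (fun T => ?_) h0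
    refine intervalIntegral.norm_integral_le_of_norm_le_const fun x hx => ?_
    rw [Set.uIoc_of_le hab] at hx
    have := hC ((x : ℂ) + ((s * T : ℝ) : ℂ) * Complex.I) (by simpa using hx.1.le)
      (by simpa using hx.2)
    have him : ((x : ℂ) + ((s * T : ℝ) : ℂ) * Complex.I).im = s * T := by simp
    rwa [him, mul_pow, hs, one_mul] at this
  have rect : ∀ T : ℝ, (∫ x : ℝ in a..b, g ((x : ℂ) + (((-1) * T : ℝ) : ℂ) * Complex.I)) -
      (∫ x : ℝ in a..b, g ((x : ℂ) + ((1 * T : ℝ) : ℂ) * Complex.I)) +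
      Complex.I • (∫ y : ℝ in (-T)..T, g ((b : ℂ) + (y : ℂ) * Complex.I)) -
      Complex.I • (∫ y : ℝ in (-T)..T, g ((a : ℂ) + (y : ℂ) * Complex.I)) = 0 := by
    intro T
    have := Complex.integral_boundary_rect_eq_zero_of_differentiableOn g ⟨a, -T⟩ ⟨b, T⟩
      (fun z hz => by
        have hz1 := hz.1
        simp only [Set.mem_preimage, Set.uIcc_of_le hab, Set.mem_Icc] at hz1
        exact (hd z hz1.1 hz1.2).differentiableWithinAt)
    simpa using this
  have hlim := (((horiz (-1) (by norm_num)).sub (horiz 1 (by norm_num))).add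
    ((lim b hab le_rfl).const_smul Complex.I)).sub ((lim a le_rfl hab).const_smul Complex.I)
  simp only [rect] at hlim
  have := tendsto_nhds_unique hlim tendsto_const_nhds
  rw [sub_self, zero_add, ← smul_sub, smul_eq_mul, mul_eq_zero, sub_eq_zero] at this
  exact (this.resolve_left Complex.I_ne_zero).symm

theorem Complex.differentiableAt_Gamma_of_re_pos {z : ℂ} (hz : 0 < z.re) :
    DifferentiableAt ℂ Complex.Gamma z := by
  refine Complex.differentiableAt_Gamma z fun m h => ?_
  rw [h] at hz
  simp at hz
  linarith [(Nat.cast_nonneg m : (0 : ℝ) ≤ m)]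

theorem differentiableAt_list_prod {ι : Type*} (l : List ι) (f : ι → ℂ → ℂ) {z : ℂ}
    (H : ∀ i ∈ l, DifferentiableAt ℂ (f i) z) :
    DifferentiableAt ℂ (fun z => (l.map fun i => f i z).prod) z := by
  induction l with
  | nil => simp
  | cons i l ih =>
    simp only [List.map_cons, List.prod_cons]
    exact (H i (by simp)).mul (ih fun j hj => H j (by simp [hj]))

/-! ### Fox kernels and the Laplace integrand -/

namespace FoxHParam

variable {P : FoxHParam} {σ τ : ℝ}

/-- The conditions are affine in the abscissa, so a shift between two separating lines meets no pole
of the kernel. -/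
theorem Separates.of_mem_Icc (h1 : P.Separates σ) (h2 : P.Separates τ) {x : ℝ}
    (hx : x ∈ Set.Icc σ τ) : P.Separates x := by
  have aux : ∀ p q : ℝ, 0 < p + q * σ → 0 < p + q * τ → 0 < p + q * x := by
    intro p q hp hq
    rcases le_total 0 q with h | h
    · nlinarith [mul_le_mul_of_nonneg_left hx.1 h]
    · nlinarith [mul_le_mul_of_nonpos_left hx.2 h]
  refine ⟨fun r hr => ?_, fun r hr => aux _ _ (h1.2 r hr) (h2.2 r hr)⟩
  have := aux r.1 (-r.2) (by linarith [h1.1 r hr]) (by linarith [h2.1 r hr])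
  linarith

/-- The denominator needs no condition because `1/Γ` is entire, and its zeros agree with the
convention for division by zero. -/
theorem differentiableAt_kernel {z : ℂ} (h : P.Separates z.re) :
    DifferentiableAt ℂ P.kernel z := by
  have num1 : DifferentiableAt ℂ (fun z : ℂ =>
      (P.dNum.map fun r => Complex.Gamma ((r.1 : ℂ) - (r.2 : ℂ) * z)).prod) z :=
    differentiableAt_list_prod _ (fun (r : ℝ × ℝ) (z : ℂ) => Complex.Gamma ((r.1 : ℂ) - (r.2 : ℂ) * z)) fun r hr =>
      DifferentiableAt.comp (f := fun z : ℂ => (r.1 : ℂ) - (r.2 : ℂ) * z) z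
        (Complex.differentiableAt_Gamma_of_re_pos (by simpa using h.1 r hr)) (by fun_prop)
  have num2 : DifferentiableAt ℂ (fun z : ℂ =>
      (P.cNum.map fun r => Complex.Gamma (1 - (r.1 : ℂ) + (r.2 : ℂ) * z)).prod) z :=
    differentiableAt_list_prod _ (fun (r : ℝ × ℝ) (z : ℂ) => Complex.Gamma (1 - (r.1 : ℂ) + (r.2 : ℂ) * z))
      fun r hr => DifferentiableAt.comp (f := fun z : ℂ => 1 - (r.1 : ℂ) + (r.2 : ℂ) * z) z
        (Complex.differentiableAt_Gamma_of_re_pos (by simpa using h.2 r hr)) (by fun_prop)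
  have den1 : DifferentiableAt ℂ (fun z : ℂ =>
      (P.cDen.map fun r => (Complex.Gamma ((r.1 : ℂ) - (r.2 : ℂ) * z))⁻¹).prod) z :=
    differentiableAt_list_prod _ (fun (r : ℝ × ℝ) (z : ℂ) => (Complex.Gamma ((r.1 : ℂ) - (r.2 : ℂ) * z))⁻¹)
      fun r _ => DifferentiableAt.comp (f := fun z : ℂ => (r.1 : ℂ) - (r.2 : ℂ) * z) z
        (Complex.differentiable_one_div_Gamma _) (by fun_prop)
  have den2 : DifferentiableAt ℂ (fun z : ℂ =>
      (P.dDen.map fun r => (Complex.Gamma (1 - (r.1 : ℂ) + (r.2 : ℂ) * z))⁻¹).prod) z :=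
    differentiableAt_list_prod _ (fun (r : ℝ × ℝ) (z : ℂ) => (Complex.Gamma (1 - (r.1 : ℂ) + (r.2 : ℂ) * z))⁻¹)
      fun r _ => DifferentiableAt.comp (f := fun z : ℂ => 1 - (r.1 : ℂ) + (r.2 : ℂ) * z) z
        (Complex.differentiable_one_div_Gamma _) (by fun_prop)
  refine ((num1.mul num2).mul (den1.mul den2)).congr_of_eventuallyEq
    (Filter.Eventually.of_forall fun w => ?_)
  simp only [kernel, div_eq_mul_inv, Pi.mul_apply, mul_inv, List.prod_inv, List.map_map]
  rfl

/-- The exponential rate of the kernel along vertical lines. -/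
theorem exists_verticalGrowth_kernel (hC : ∀ r ∈ P.cNum ++ P.cDen, 0 < r.2)
    (hD : ∀ r ∈ P.dNum ++ P.dDen, 0 < r.2) :
    ∃ α : ℝ, ∀ a b, VerticalGrowth a b α P.kernel := by
  have H1 : ∀ (r : ℝ × ℝ), 0 < r.2 → ∀ a b : ℝ, VerticalGrowth a b (-(Real.pi / 2) * |r.2|)
      (fun z => Complex.Gamma ((r.1 : ℂ) - (r.2 : ℂ) * z)) := fun r hr a b => by
    have := VerticalGrowth.comp_affine (a := a) (b := b) Complex.verticalGrowth_Gamma r.1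
      (neg_ne_zero.mpr hr.ne')
    rw [abs_neg] at this
    simpa [sub_eq_add_neg] using this
  have H2 : ∀ (r : ℝ × ℝ), 0 < r.2 → ∀ a b : ℝ, VerticalGrowth a b (-(Real.pi / 2) * |r.2|)
      (fun z => Complex.Gamma (1 - (r.1 : ℂ) + (r.2 : ℂ) * z)) := fun r hr a b => by
    have := VerticalGrowth.comp_affine (a := a) (b := b) Complex.verticalGrowth_Gamma (1 - r.1)
      hr.ne'
    simpa using this
  let rate : ℝ × ℝ → ℝ := fun r => -(Real.pi / 2) * |r.2|
  refine ⟨(P.dNum.map rate).sum + (P.cNum.map rate).sum +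
    -((P.cDen.map rate).sum + (P.dDen.map rate).sum), fun a b => ?_⟩
  have K1 := VerticalGrowth.list_prod P.dNum _ rate
    fun r hr => H1 r (hD r (List.mem_append_left _ hr)) a b
  have K2 := VerticalGrowth.list_prod P.cNum _ rate
    fun r hr => H2 r (hC r (List.mem_append_left _ hr)) a b
  have K3 := VerticalGrowth.list_prod P.cDen _ rate
    fun r hr => H1 r (hC r (List.mem_append_right _ hr)) a b
  have K4 := VerticalGrowth.list_prod P.dDen _ rate
    fun r hr => H2 r (hD r (List.mem_append_right _ hr)) a b
  exact (K1.mul K2).mul (K3.mul K4).inv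

/-- One rate holds on all lines, so integrability on the given contour bounds it everywhere. The
rate may be `0`, in which case the kernel need not be integrable on other lines. -/
theorem IsDensityComponent.exists_verticalGrowth (h : P.IsDensityComponent) :
    ∃ α : ℝ, α ≤ 0 ∧ ∀ a b, VerticalGrowth a b α P.kernel := by
  obtain ⟨α, hα⟩ := exists_verticalGrowth_kernel h.C_pos h.D_pos
  obtain ⟨σ, _, hσ⟩ := h.exists_contour
  exact ⟨α, (hα σ σ).nonpos_of_integrable le_rfl le_rfl hσ, hα⟩

/-- This is all that the conditions on `c_i + C_i` and `d_i / D_i` are needed for. -/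
theorem IsDensityComponent.separates_neg_one (h : P.IsDensityComponent) : P.Separates (-1) := by
  refine ⟨fun r hr => ?_, fun r hr => ?_⟩
  · have h1 := h.d_lt r hr
    have h2 := h.D_pos r (List.mem_append_left _ hr)
    rw [neg_lt, lt_div_iff₀ h2] at h1
    linarith
  · linarith [h.c_lt r hr]

/-- The integrand of the Mellin-Barnes representation of the transform `∫ x^n e^{-rx} f(x) dx` of
`f(x) = H[x]`. -/
noncomputable def laplaceIntegrand (P : FoxHParam) (n : ℕ) (r : ℝ) (z : ℂ) : ℂ :=
  P.kernel z * (P.v : ℂ) ^ z * (Complex.Gamma (z + n + 1) * (r : ℂ) ^ (-z - n - 1))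

theorem differentiableAt_laplaceIntegrand (hv : 0 < P.v) {n : ℕ} {r : ℝ} (hr : 0 < r) {z : ℂ}
    (hz : P.Separates z.re) (hn : 0 < z.re + n + 1) :
    DifferentiableAt ℂ (P.laplaceIntegrand n r) z := by
  have hv' : (P.v : ℂ) ≠ 0 := by exact_mod_cast hv.ne'
  have hr' : (r : ℂ) ≠ 0 := by exact_mod_cast hr.ne'
  refine ((differentiableAt_kernel hz).mul ?_).mul (DifferentiableAt.mul ?_ ?_)
  · exact DifferentiableAt.const_cpow differentiableAt_id (Or.inl hv')
  · exact DifferentiableAt.comp (f := fun z : ℂ => z + n + 1) z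
      (Complex.differentiableAt_Gamma_of_re_pos (by simpa using hn)) (by fun_prop)
  · exact DifferentiableAt.const_cpow (by fun_prop) (Or.inl hr')

/-- The factor `Γ(z+n+1)` adds `-π/2` to a rate that is at most `0`; the powers of `v` and `r` add
nothing. -/
theorem IsDensityComponent.verticalGrowth_laplaceIntegrand (h : P.IsDensityComponent) (n : ℕ)
    {r : ℝ} (hr : 0 < r) :
    ∃ α : ℝ, α < 0 ∧ ∀ a b, VerticalGrowth a b α (P.laplaceIntegrand n r) := by
  obtain ⟨α, hα, H⟩ := h.exists_verticalGrowth
  refine ⟨α + 0 + (-(Real.pi / 2) + 0), by linarith [Real.pi_pos], fun a b => ?_⟩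
  refine ((H a b).mul (VerticalGrowth.const_cpow h.v_pos)).mul (VerticalGrowth.mul ?_ ?_)
  · have := VerticalGrowth.comp_add (a := a) (b := b) (a' := n + 1) (Complex.verticalGrowth_Gamma _ _)
    simpa [add_assoc] using this
  · have h1 := VerticalGrowth.mul (VerticalGrowth.const_cpow (a := a) (b := b) hr).inv
      (VerticalGrowth.of_le_of_le (g := fun _ => (r : ℂ) ^ (-(n : ℂ) - 1))
        (c := ‖(r : ℂ) ^ (-(n : ℂ) - 1)‖) (by
          simp [Complex.cpow_eq_zero_iff, hr.ne'])
        (fun _ _ _ => le_rfl) (fun _ _ _ => le_rfl))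
    rw [neg_zero, add_zero] at h1
    refine h1.congr fun z _ => ?_
    rw [← Complex.cpow_neg, ← Complex.cpow_add _ _ (by exact_mod_cast hr.ne')]
    congr 1
    ring

theorem IsDensityComponent.exists_norm_laplaceIntegrand_le (h : P.IsDensityComponent) {n : ℕ}
    {r : ℝ} (hr : 0 < r) (h1 : P.Separates σ) (h2 : P.Separates τ) (hn : 0 < σ + n + 1) :
    ∃ C : ℝ, 0 ≤ C ∧ ∀ z : ℂ, σ ≤ z.re → z.re ≤ τ →
      ‖P.laplaceIntegrand n r z‖ ≤ C * (1 + z.im ^ 2)⁻¹ := by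
  obtain ⟨α, hα, H⟩ := h.verticalGrowth_laplaceIntegrand n hr
  exact (H σ τ).exists_norm_le hα fun z hz hz' =>
    (differentiableAt_laplaceIntegrand h.v_pos hr (h1.of_mem_Icc h2 ⟨hz, hz'⟩)
      (by linarith)).continuousAt

theorem IsDensityComponent.integrable_laplaceIntegrand (h : P.IsDensityComponent) {n : ℕ}
    {r : ℝ} (hr : 0 < r) (h1 : P.Separates σ) (hn : 0 < σ + n + 1) :
    Integrable (fun y : ℝ => P.laplaceIntegrand n r ((σ : ℂ) + (y : ℂ) * Complex.I)) := by
  obtain ⟨C, _, H⟩ := h.exists_norm_laplaceIntegrand_le hr h1 h1 hn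
  exact integrable_verticalLine_of_norm_le (fun z hz hz' =>
    (differentiableAt_laplaceIntegrand h.v_pos hr (h1.of_mem_Icc h1 ⟨hz, hz'⟩)
      (by linarith)).continuousAt) H le_rfl le_rfl

/-- Both lines lie to the right of the poles of `Γ(z+n+1)`, so a shift in either direction crosses
no pole. -/
theorem IsDensityComponent.integral_laplaceIntegrand_eq (h : P.IsDensityComponent) {n : ℕ}
    {r : ℝ} (hr : 0 < r) (h1 : P.Separates σ) (h2 : P.Separates τ) (hn1 : 0 < σ + n + 1)
    (hn2 : 0 < τ + n + 1) :
    ∫ y : ℝ, P.laplaceIntegrand n r ((σ : ℂ) + (y : ℂ) * Complex.I) =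
      ∫ y : ℝ, P.laplaceIntegrand n r ((τ : ℂ) + (y : ℂ) * Complex.I) := by
  have key : ∀ σ τ : ℝ, P.Separates σ → P.Separates τ → 0 < σ + n + 1 → σ ≤ τ →
      ∫ y : ℝ, P.laplaceIntegrand n r ((σ : ℂ) + (y : ℂ) * Complex.I) =
      ∫ y : ℝ, P.laplaceIntegrand n r ((τ : ℂ) + (y : ℂ) * Complex.I) := by
    intro σ τ h1 h2 hn hle
    obtain ⟨C, _, H⟩ := h.exists_norm_laplaceIntegrand_le hr h1 h2 hn
    exact integral_verticalLine_eq hle (fun z hz hz' =>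
      differentiableAt_laplaceIntegrand h.v_pos hr (h1.of_mem_Icc h2 ⟨hz, hz'⟩) (by linarith)) H
  rcases le_total σ τ with hle | hle
  · exact key σ τ h1 h2 hn1 hle
  · exact (key τ σ h2 h1 hn2 hle).symm

end FoxHParam

/-! ### Laplace transforms under the Mellin-Barnes integral -/

/-- The Fubini criterion for Mellin-Barnes integrands: on a vertical line the modulus of `x^z`
depends on `x` only, so the bound factors. -/
theorem integrable_prod_Ioi_of_norm_le {β E : Type*} [MeasurableSpace β] [NormedAddCommGroup E]
    {ν : Measure β} [SFinite ν] {c : ℝ} {F : ℝ × β → E} {g : ℝ → ℝ} {h : β → ℝ}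
    (hF : AEStronglyMeasurable F ((volume.restrict (Set.Ioi c)).prod ν))
    (hg : IntegrableOn g (Set.Ioi c)) (hh : Integrable h ν)
    (H : ∀ x, c < x → ∀ y, ‖F (x, y)‖ ≤ g x * h y) :
    Integrable F ((volume.restrict (Set.Ioi c)).prod ν) := by
  refine Integrable.mono' (hg.mul_prod hh) hF ?_
  have h1 : ∀ᵐ x ∂(volume.restrict (Set.Ioi c)), x ∈ Set.Ioi c := ae_restrict_mem measurableSet_Ioi
  filter_upwards [Measure.quasiMeasurePreserving_fst.ae h1] with p hp
  exact H p.1 hp p.2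

theorem integrableOn_rpow_mul_exp_neg {a r : ℝ} (ha : -1 < a) (hr : 0 < r) :
    IntegrableOn (fun x : ℝ => x ^ a * Real.exp (-(r * x))) (Set.Ioi 0) := by
  have := integrableOn_rpow_mul_exp_neg_mul_rpow ha one_pos hr
  simpa [neg_mul] using this

namespace FoxHParam

variable {P : FoxHParam} {σ τ : ℝ}

theorem IsDensityComponent.isContour_contour (h : P.IsDensityComponent) :
    P.IsContour P.contour :=
  Classical.epsilon_spec h.exists_contour

/-- Termwise Laplace transform of `x^n H[x]`, for `n` large enough. -/
theorem IsDensityComponent.laplace_foxH (h : P.IsDensityComponent) {n : ℕ} {r : ℝ} (hr : 0 < r)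
    (hn : 0 < P.contour + n + 1) :
    IntegrableOn (fun x : ℝ => ((x ^ n * Real.exp (-(r * x)) : ℝ) : ℂ) * P.foxH x) (Set.Ioi 0) ∧
    ∫ x in Set.Ioi (0 : ℝ), ((x ^ n * Real.exp (-(r * x)) : ℝ) : ℂ) * P.foxH x =
      ((P.u : ℂ) / (2 * (Real.pi : ℂ))) *
        ∫ y : ℝ, P.laplaceIntegrand n r ((P.contour : ℂ) + (y : ℂ) * Complex.I) := by
  obtain ⟨_, hint⟩ := h.isContour_contour
  set σ := P.contour with hσ
  have hv := h.v_pos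
  let F : ℝ × ℝ → ℂ := fun p => ((p.1 ^ n * Real.exp (-(r * p.1)) : ℝ) : ℂ) *
    (P.kernel ((σ : ℂ) + (p.2 : ℂ) * Complex.I) *
      ((P.v * p.1 : ℝ) : ℂ) ^ ((σ : ℂ) + (p.2 : ℂ) * Complex.I))
  have hF : Integrable F ((volume.restrict (Set.Ioi 0)).prod volume) := by
    -- Integrability of `x ^ (σ + n)` at `0` is where `n` must be large.
    refine integrable_prod_Ioi_of_norm_le (g := fun x => x ^ (σ + n) * Real.exp (-(r * x)))
      (h := fun y => P.v ^ σ * ‖P.kernel ((σ : ℂ) + (y : ℂ) * Complex.I)‖) ?_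
      (integrableOn_rpow_mul_exp_neg (by linarith) hr) (hint.norm.const_mul _) ?_
    · refine AEStronglyMeasurable.mul (Measurable.aestronglyMeasurable (by fun_prop))
        (AEStronglyMeasurable.mul hint.aestronglyMeasurable.comp_snd
          (Measurable.aestronglyMeasurable (by fun_prop)))
    · intro x hx y
      have hre : ((σ : ℂ) + (y : ℂ) * Complex.I).re = σ := by simp
      simp only [F, norm_mul]
      rw [Complex.norm_cpow_eq_rpow_re_of_pos (by positivity), hre, Complex.norm_real,
        Real.norm_of_nonneg (by positivity), Real.mul_rpow hv.le hx.le, Real.rpow_add hx,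
        Real.rpow_natCast]
      apply le_of_eq
      ring
  have hfox : ∀ x : ℝ, ((x ^ n * Real.exp (-(r * x)) : ℝ) : ℂ) * P.foxH x =
      ((P.u : ℂ) / (2 * (Real.pi : ℂ))) * ∫ y : ℝ, F (x, y) := by
    intro x
    simp only [F, integral_const_mul, foxH, ← hσ]
    ring
  simp only [hfox]
  refine ⟨hF.integral_prod_left.const_mul _, ?_⟩
  rw [integral_const_mul]
  congr 1
  rw [integral_integral_swap (f := fun x y => F (x, y)) hF]
  congr 1
  ext y
  set z := (σ : ℂ) + (y : ℂ) * Complex.I with hz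
  have hre : z.re = σ := by simp [hz]
  have hre' : (z + n + 1).re = σ + n + 1 := by simp [hre]
  have hG := Complex.integral_cpow_mul_exp_neg_mul_Ioi (a := z + n + 1) (r := r)
    (by rw [hre']; exact hn) (by simpa using hr)
  calc ∫ x in Set.Ioi (0 : ℝ), F (x, y)
      = ∫ x in Set.Ioi (0 : ℝ), (P.kernel z * (P.v : ℂ) ^ z) *
          ((x : ℂ) ^ (z + n + 1 - 1) * Complex.exp (-((r : ℂ) * x))) := by
        refine setIntegral_congr_fun measurableSet_Ioi fun x hx => ?_
        have hx' : (0 : ℝ) < x := hx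
        have hx0 : (x : ℂ) ≠ 0 := by exact_mod_cast hx'.ne'
        simp only [F, ← hz]
        rw [Complex.ofReal_mul P.v x, Complex.mul_cpow_ofReal_nonneg hv.le hx'.le,
          add_sub_cancel_right, Complex.cpow_add z n hx0, Complex.cpow_natCast]
        push_cast
        ring
    _ = _ := by
        rw [integral_const_mul, hG, laplaceIntegrand, one_div,
          Complex.inv_cpow _ _ (by
            rw [Complex.arg_ofReal_of_nonneg hr.le]
            exact Real.pi_pos.ne), ← Complex.cpow_neg, mul_comm (Complex.Gamma _)]
        congr 3
        ring

/-- Integration over `(s, ∞)` lowers the order of the Laplace integrand. -/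
theorem IsDensityComponent.integral_Ioi_laplaceIntegrand (h : P.IsDensityComponent) {n : ℕ}
    {s : ℝ} (hs : 0 < s) (hτ : P.Separates τ) (hn : 0 < τ + n + 1) :
    IntegrableOn (fun r : ℝ => ∫ y : ℝ, P.laplaceIntegrand (n + 1) r
      ((τ : ℂ) + (y : ℂ) * Complex.I)) (Set.Ioi s) ∧
    ∫ r in Set.Ioi s, ∫ y : ℝ, P.laplaceIntegrand (n + 1) r ((τ : ℂ) + (y : ℂ) * Complex.I) =
      ∫ y : ℝ, P.laplaceIntegrand n s ((τ : ℂ) + (y : ℂ) * Complex.I) := by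
  -- At `r = 1` the power of `r` disappears, leaving the part of the integrand that does not depend
  -- on `r`.
  have hint := h.integrable_laplaceIntegrand (n := n + 1) one_pos hτ (by push_cast; linarith)
  simp only [laplaceIntegrand, Complex.ofReal_one, Complex.one_cpow, mul_one] at hint
  let F : ℝ × ℝ → ℂ := fun p =>
    P.laplaceIntegrand (n + 1) p.1 ((τ : ℂ) + (p.2 : ℂ) * Complex.I)
  have hF : Integrable F ((volume.restrict (Set.Ioi s)).prod volume) := by
    refine integrable_prod_Ioi_of_norm_le (g := fun x => x ^ (-τ - n - 2))
      (h := fun y => ‖P.kernel ((τ : ℂ) + (y : ℂ) * Complex.I) *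
        (P.v : ℂ) ^ ((τ : ℂ) + (y : ℂ) * Complex.I) *
        Complex.Gamma ((τ : ℂ) + (y : ℂ) * Complex.I + (n + 1 : ℕ) + 1)‖) ?_
      (integrableOn_Ioi_rpow_of_lt (by linarith) hs) hint.norm ?_
    · have : F = fun p => (P.kernel ((τ : ℂ) + (p.2 : ℂ) * Complex.I) *
        (P.v : ℂ) ^ ((τ : ℂ) + (p.2 : ℂ) * Complex.I) *
        Complex.Gamma ((τ : ℂ) + (p.2 : ℂ) * Complex.I + (n + 1 : ℕ) + 1)) *
        (p.1 : ℂ) ^ (-((τ : ℂ) + (p.2 : ℂ) * Complex.I) - (n + 1 : ℕ) - 1) := by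
          ext p
          simp only [F, laplaceIntegrand]
          ring
      rw [this]
      exact AEStronglyMeasurable.mul hint.aestronglyMeasurable.comp_snd
          (Measurable.aestronglyMeasurable (by fun_prop))
    · intro x hx y
      have hx0 : 0 < x := hs.trans hx
      have hre : (-((τ : ℂ) + (y : ℂ) * Complex.I) - (n + 1 : ℕ) - 1).re = -τ - n - 2 := by
        simp
        ring
      simp only [F, laplaceIntegrand, norm_mul]
      rw [Complex.norm_cpow_eq_rpow_re_of_pos hx0, hre]
      apply le_of_eq
      ring
  refine ⟨hF.integral_prod_left, ?_⟩
  rw [integral_integral_swap (f := fun x y => F (x, y)) hF]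
  congr 1
  ext y
  set z := (τ : ℂ) + (y : ℂ) * Complex.I with hz
  have hre : z.re = τ := by simp [hz]
  have hz0 : z + n + 1 ≠ 0 := fun h0 => by
    have := congrArg Complex.re h0
    simp [hre] at this
    linarith
  have h1 : ∫ r in Set.Ioi s, (r : ℂ) ^ (-z - (n + 1 : ℕ) - 1) = _ :=
    integral_Ioi_cpow_of_lt (a := -z - (n + 1 : ℕ) - 1) (by simp [hre]; linarith) hs
  simp only [F, laplaceIntegrand, ← hz, integral_const_mul, h1]
  have e1 : z + (n + 1 : ℕ) + 1 = (z + n + 1) + 1 := by push_cast; ring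
  have e2 : -z - (n + 1 : ℕ) - 1 + 1 = -z - n - 1 := by push_cast; ring
  -- `Γ(z+n+2) = (z+n+1) Γ(z+n+1)` cancels the denominator left by integrating the power of `r`.
  rw [e1, e2, Complex.Gamma_add_one _ hz0]
  have e3 : -z - (n : ℂ) - 1 = -(z + n + 1) := by ring
  rw [e3]
  field_simp

/-! ### The Mellin operation as the reflection `z = -1 - w` -/

theorem kernel_toMGF (P : FoxHParam) (w : ℂ) :
    P.toMGF.kernel w = Complex.Gamma (-w) * P.kernel (-1 - w) := by
  have e1 : ∀ r : ℝ × ℝ, 1 - (r.1 : ℂ) - r.2 - r.2 * w = 1 - r.1 + r.2 * (-1 - w) := fun r => by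
    ring
  have e2 : ∀ r : ℝ × ℝ, 1 - (1 - (r.1 : ℂ) - r.2) + r.2 * w = r.1 - r.2 * (-1 - w) := fun r => by
    ring
  simp only [kernel, toMGF, mellinOp, mgfParam, List.nil_append, List.append_nil, List.map_append,
    List.map_map, List.prod_append, Function.comp_def, List.map_cons, List.map_nil, List.prod_cons,
    List.prod_nil, Complex.ofReal_sub, Complex.ofReal_one, e1, e2, Complex.ofReal_zero, zero_sub,
    one_mul, mul_one]
  ring

/-- The factor `Γ(-w)` contributes `σ < 0`, which says that the reflected line lies to the right of
`-1`. -/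
theorem separates_toMGF_iff : P.toMGF.Separates σ ↔ σ < 0 ∧ P.Separates (-1 - σ) := by
  simp only [Separates, toMGF, mellinOp, mgfParam, List.nil_append, List.mem_append,
    List.mem_singleton, List.mem_map]
  constructor
  · rintro ⟨h1, h2⟩
    refine ⟨by simpa using h1 (0, 1) (Or.inl rfl), fun r hr => ?_, fun r hr => ?_⟩
    · have := h2 _ ⟨r, hr, rfl⟩
      simp only at this
      linarith
    · have := h1 _ (Or.inr ⟨r, hr, rfl⟩)
      simp only at this
      linarith
  · rintro ⟨h0, h1, h2⟩
    refine ⟨?_, ?_⟩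
    · rintro r (rfl | ⟨r', hr, rfl⟩)
      · simpa using h0
      · have := h2 _ hr
        simp only
        linarith
    · rintro r ⟨r', hr, rfl⟩
      have := h1 _ hr
      simp only
      linarith

/-- The factor `v` on the right will cancel against the constant `u/v` of `toMGF`. -/
theorem kernel_toMGF_mul_cpow (hv : 0 < P.v) {s : ℝ} (hs : 0 < s) (w : ℂ) :
    P.toMGF.kernel w * ((P.toMGF.v * s : ℝ) : ℂ) ^ w =
      P.v * P.laplaceIntegrand 0 s (-1 - w) := by
  have hv0 : (P.v : ℂ) ≠ 0 := by exact_mod_cast hv.ne'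
  have hmv : P.toMGF.v = P.v⁻¹ := by simp [toMGF, mellinOp, mgfParam]
  rw [kernel_toMGF, laplaceIntegrand, hmv, Complex.ofReal_mul,
    Complex.mul_cpow_ofReal_nonneg (by positivity) hs.le, Complex.ofReal_inv, Complex.inv_cpow _ _ (by
            rw [Complex.arg_ofReal_of_nonneg hv.le]
            exact Real.pi_pos.ne), ← Complex.cpow_neg, Complex.cpow_sub _ _ hv0, Complex.cpow_neg,
    Complex.cpow_neg, Complex.cpow_one]
  have e1 : -1 - w + (0 : ℕ) + 1 = -w := by push_cast; ring
  have e2 : -(-1 - w) - (0 : ℕ) - 1 = w := by push_cast; ring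
  rw [e1, e2]
  field_simp

theorem IsDensityComponent.integrable_toMGF (h : P.IsDensityComponent)
    (hσ : P.toMGF.Separates σ) :
    Integrable (fun y : ℝ => P.toMGF.kernel ((σ : ℂ) + (y : ℂ) * Complex.I)) := by
  obtain ⟨h0, h1⟩ := separates_toMGF_iff.mp hσ
  have h2 := ((h.integrable_laplaceIntegrand (n := 0) h.v_pos h1 
    (by push_cast; linarith)).comp_neg).const_mul (P.v : ℂ)
  refine h2.congr (Filter.Eventually.of_forall fun y => ?_)
  -- With argument `s = P.v` the power `(v_φ s)^w` is `1`, so the integrand is the bare kernel.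
  have hv : P.toMGF.v * P.v = 1 := by
    simp [toMGF, mellinOp, mgfParam, h.v_pos.ne']
  have h3 := kernel_toMGF_mul_cpow h.v_pos h.v_pos ((σ : ℂ) + (y : ℂ) * Complex.I)
  rw [hv, Complex.ofReal_one, Complex.one_cpow, mul_one] at h3
  simp only [h3]
  congr 2
  push_cast
  ring

theorem IsDensityComponent.isContour_toMGF_iff (h : P.IsDensityComponent) :
    P.toMGF.IsContour σ ↔ P.toMGF.Separates σ :=
  ⟨fun H => H.1, fun H => ⟨H, h.integrable_toMGF H⟩⟩

/-- Separation at `-1` is an open condition, so it persists at `-1 - σ` for small `σ < 0`. The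
freedom in `ε` is needed for the constraint coupling all variables. -/
theorem IsDensityComponent.exists_separates_toMGF (h : P.IsDensityComponent) {ε : ℝ}
    (hε : 0 < ε) : ∃ σ : ℝ, -ε < σ ∧ P.toMGF.Separates σ := by
  have ev : ∀ p q : ℝ, 0 < p + q * (-1) → ∀ᶠ σ in nhds (0 : ℝ), 0 < p + q * (-1 - σ) := by
    intro p q hpq
    have : ContinuousAt (fun σ : ℝ => p + q * (-1 - σ)) 0 := by fun_prop
    exact this.eventually (lt_mem_nhds (by simpa using hpq))
  have hs := h.separates_neg_one
  have h1 : ∀ᶠ σ in nhds (0 : ℝ), ∀ r ∈ P.dNum.toFinset, 0 < r.1 + -r.2 * (-1 - σ) :=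
    (Filter.eventually_all_finset _).mpr fun r hr =>
      ev r.1 (-r.2) (by linarith [hs.1 r (List.mem_toFinset.mp hr)])
  have h2 : ∀ᶠ σ in nhds (0 : ℝ), ∀ r ∈ P.cNum.toFinset, 0 < (1 - r.1) + r.2 * (-1 - σ) :=
    (Filter.eventually_all_finset _).mpr fun r hr =>
      ev (1 - r.1) r.2 (hs.2 r (List.mem_toFinset.mp hr))
  have h3 : ∀ᶠ σ in nhds (0 : ℝ), -ε < σ := lt_mem_nhds (by linarith)
  have h4 : ∀ᶠ σ in nhdsWithin (0 : ℝ) (Set.Iio 0), σ < 0 := self_mem_nhdsWithin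
  obtain ⟨σ, ⟨⟨k1, k2⟩, k3⟩, k4⟩ :=
    (((h1.and h2).and h3).filter_mono nhdsWithin_le_nhds |>.and h4).exists
  refine ⟨σ, k3, separates_toMGF_iff.mpr ⟨k4, fun r hr => ?_, fun r hr => ?_⟩⟩
  · linarith [k1 r (List.mem_toFinset.mpr hr)]
  · exact k2 r (List.mem_toFinset.mpr hr)

theorem IsDensityComponent.exists_isContour_toMGF (h : P.IsDensityComponent) :
    ∃ σ : ℝ, P.toMGF.IsContour σ := by
  obtain ⟨σ, _, hσ⟩ := h.exists_separates_toMGF one_pos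
  exact ⟨σ, h.isContour_toMGF_iff.mpr hσ⟩

/-- The H-function of `P_φ` along any separating line, in terms of the Laplace integrand. -/
theorem IsDensityComponent.toMGF_line_eq (h : P.IsDensityComponent) {s : ℝ} (hs : 0 < s)
    (σ : ℝ) :
    ((P.toMGF.u : ℂ) / (2 * (Real.pi : ℂ))) *
      ∫ y : ℝ, P.toMGF.kernel ((σ : ℂ) + (y : ℂ) * Complex.I) *
        ((P.toMGF.v * s : ℝ) : ℂ) ^ ((σ : ℂ) + (y : ℂ) * Complex.I) =
    ((P.u : ℂ) / (2 * (Real.pi : ℂ))) *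
      ∫ y : ℝ, P.laplaceIntegrand 0 s (((-1 - σ : ℝ) : ℂ) + (y : ℂ) * Complex.I) := by
  have hv0 : (P.v : ℂ) ≠ 0 := by exact_mod_cast h.v_pos.ne'
  have hu : (P.toMGF.u : ℂ) = P.u / P.v := by simp [toMGF, mellinOp, mgfParam]
  simp only [kernel_toMGF_mul_cpow h.v_pos hs, integral_const_mul]
  -- The reflection reverses the direction of the line.
  rw [← integral_neg_eq_self (fun y : ℝ =>
    P.laplaceIntegrand 0 s (((-1 - σ : ℝ) : ℂ) + (y : ℂ) * Complex.I)), hu]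
  have e : ∀ y : ℝ, -1 - ((σ : ℂ) + (y : ℂ) * Complex.I) =
      ((-1 - σ : ℝ) : ℂ) + ((-y : ℝ) : ℂ) * Complex.I := fun y => by push_cast; ring
  simp only [e]
  have key : ∀ J : ℂ, (P.u : ℂ) / P.v / (2 * Real.pi) * (P.v * J) = P.u / (2 * Real.pi) * J :=
    fun J => by field_simp
  exact key _

/-- The H-function of `P_φ` may be computed along any separating line. -/
theorem IsDensityComponent.foxH_toMGF_eq (h : P.IsDensityComponent) {s : ℝ} (hs : 0 < s)
    (hσ : P.toMGF.Separates σ) :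
    P.toMGF.foxH s = ((P.toMGF.u : ℂ) / (2 * (Real.pi : ℂ))) *
      ∫ y : ℝ, P.toMGF.kernel ((σ : ℂ) + (y : ℂ) * Complex.I) *
        ((P.toMGF.v * s : ℝ) : ℂ) ^ ((σ : ℂ) + (y : ℂ) * Complex.I) := by
  have h1 : P.toMGF.IsContour P.toMGF.contour := Classical.epsilon_spec h.exists_isContour_toMGF
  obtain ⟨a1, b1⟩ := separates_toMGF_iff.mp h1.1
  obtain ⟨a2, b2⟩ := separates_toMGF_iff.mp hσ
  rw [foxH, h.toMGF_line_eq hs, h.toMGF_line_eq hs, h.integral_laplaceIntegrand_eq hs b1 b2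
    (by push_cast; linarith) (by push_cast; linarith)]

end FoxHParam

/-! ### Moment generating functions of the gains -/

namespace FoxHParam

/-- Fubini gives measurability after multiplication by `x^n e^(-x)`, which does not vanish on `(0,
∞)`. -/
theorem IsDensityComponent.aestronglyMeasurable_foxH {P : FoxHParam} (h : P.IsDensityComponent) :
    AEStronglyMeasurable P.foxH (volume.restrict (Set.Ioi 0)) := by
  obtain ⟨n, hn⟩ := exists_nat_gt (-P.contour - 1)
  have h1 := (h.laplace_foxH (n := n) one_pos (by linarith)).1.aestronglyMeasurable
  have h2 : Measurable (fun x : ℝ => (((x ^ n * Real.exp (-(1 * x)) : ℝ) : ℂ))⁻¹) := by fun_prop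
  refine (h2.aestronglyMeasurable.mul h1).congr ?_
  filter_upwards [ae_restrict_mem measurableSet_Ioi] with x hx
  have hx' : (0 : ℝ) < x := hx
  have : ((x ^ n * Real.exp (-(1 * x)) : ℝ) : ℂ) ≠ 0 := by
    exact_mod_cast (by positivity : x ^ n * Real.exp (-(1 * x)) ≠ 0)
  simp only [Pi.mul_apply]
  rw [inv_mul_cancel_left₀ this]

end FoxHParam

namespace IsHyperFoxHFading

variable {Ω : Type*} [MeasurableSpace Ω] {μ : Measure Ω} {X : Ω → ℝ} {K : ℕ}
  {P : Fin K → FoxHParam}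

theorem ae_pos (h : IsHyperFoxHFading μ X P) : ∀ᵐ ω ∂μ, 0 < X ω := by
  obtain ⟨f, _, hlaw⟩ := h.law
  refine ae_of_ae_map h.measurable.aemeasurable (p := fun x => 0 < x) ?_
  rw [hlaw]
  exact (withDensity_absolutelyContinuous _ _).ae_le (ae_restrict_mem measurableSet_Ioi)

theorem integral_eq_sum_integral (h : IsHyperFoxHFading μ X P) {g : ℝ → ℝ} (hg : Measurable g)
    (hi : ∀ k, IntegrableOn (fun x : ℝ => (g x : ℂ) * (P k).foxH x) (Set.Ioi 0)) :
    ((∫ ω, g (X ω) ∂μ : ℝ) : ℂ) = ∑ k, ∫ x in Set.Ioi (0 : ℝ), (g x : ℂ) * (P k).foxH x := by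
  obtain ⟨f, hf, hlaw⟩ := h.law
  -- The law does not include measurability of `f`; it is inherited from the real part of the sum of
  -- H-functions.
  have hfm : AEMeasurable f (volume.restrict (Set.Ioi 0)) := by
    have h1 : AEStronglyMeasurable (fun x => ∑ k, (P k).foxH x) (volume.restrict (Set.Ioi 0)) :=
      Finset.aestronglyMeasurable_fun_sum _ fun k _ => (h.component k).aestronglyMeasurable_foxH
    refine (Complex.measurable_re.comp_aemeasurable h1.aemeasurable).congr ?_
    filter_upwards [ae_restrict_mem measurableSet_Ioi] with x hx
    simp [← (hf x hx).2]
  rw [← integral_map h.measurable.aemeasurable hg.aestronglyMeasurable, hlaw,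
    integral_withDensity_eq_integral_toReal_smul₀ hfm.ennreal_ofReal
      (Filter.Eventually.of_forall fun _ => ENNReal.ofReal_lt_top),
    ← integral_finsetSum _ fun k _ => hi k]
  refine (integral_ofReal (𝕜 := ℂ)).symm.trans (setIntegral_congr_fun measurableSet_Ioi fun x hx => ?_)
  rw [ENNReal.toReal_ofReal (hf x hx).1, ← Finset.mul_sum, ← (hf x hx).2, smul_eq_mul]
  exact (Complex.ofReal_mul _ _).trans (mul_comm _ _)

theorem integrable_pow_mul_exp [IsFiniteMeasure μ] (h : IsHyperFoxHFading μ X P) (n : ℕ) {s : ℝ}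
    (hs : 0 < s) : Integrable (fun ω => X ω ^ n * Real.exp (-(s * X ω))) μ := by
  have hX := h.measurable
  -- From the exponential series, `(sx)^n / n! ≤ e^(sx)`.
  refine Integrable.mono' (integrable_const (n.factorial / s ^ n : ℝ))
    (Measurable.aestronglyMeasurable (by fun_prop)) ?_
  filter_upwards [h.ae_pos] with ω hω
  rw [Real.norm_of_nonneg (by positivity), Real.exp_neg, ← div_eq_mul_inv,
    div_le_div_iff₀ (Real.exp_pos _) (by positivity)]
  have := Real.pow_div_factorial_le_exp (s * X ω) (by positivity) n
  rw [div_le_iff₀ (by positivity)] at this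
  calc X ω ^ n * s ^ n = (s * X ω) ^ n := by ring
    _ ≤ _ := this
    _ = _ := mul_comm _ _

/-- Integrating `x e^(-rx)` over `r > s` gives `e^(-sx)`; positivity justifies the interchange. This
is the probabilistic counterpart of `integral_Ioi_laplaceIntegrand`. -/
theorem integral_Ioi_integral_pow_mul_exp [IsFiniteMeasure μ] (h : IsHyperFoxHFading μ X P) (n : ℕ)
    {s : ℝ} (hs : 0 < s) :
    ∫ r in Set.Ioi s, ∫ ω, X ω ^ (n + 1) * Real.exp (-(r * X ω)) ∂μ =
      ∫ ω, X ω ^ n * Real.exp (-(s * X ω)) ∂μ := by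
  have hX := h.measurable
  have inner : ∀ x : ℝ, 0 < x → IntegrableOn (fun r => x ^ (n + 1) * Real.exp (-(r * x))) (Set.Ioi s)
      ∧ ∫ r in Set.Ioi s, x ^ (n + 1) * Real.exp (-(r * x)) = x ^ n * Real.exp (-(s * x)) := by
    intro x hx
    have e : ∀ r : ℝ, -(r * x) = -x * r := fun r => by ring
    simp only [e]
    refine ⟨(integrableOn_exp_mul_Ioi (neg_lt_zero.mpr hx) s).const_mul _, ?_⟩
    rw [integral_const_mul, integral_exp_mul_Ioi (neg_lt_zero.mpr hx)]
    field_simp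
    ring
  have hint : Integrable (fun p : Ω × ℝ => X p.1 ^ (n + 1) * Real.exp (-(p.2 * X p.1)))
      (μ.prod (volume.restrict (Set.Ioi s))) := by
    rw [integrable_prod_iff (Measurable.aestronglyMeasurable (by fun_prop))]
    refine ⟨?_, ?_⟩
    · filter_upwards [h.ae_pos] with ω hω
      exact (inner _ hω).1
    · refine (h.integrable_pow_mul_exp n hs).congr ?_
      filter_upwards [h.ae_pos] with ω hω
      rw [← (inner _ hω).2]
      congr 1
      ext r
      rw [Real.norm_of_nonneg (by positivity)]
  rw [← integral_integral_swap (f := fun ω r => X ω ^ (n + 1) * Real.exp (-(r * X ω))) hint]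
  refine integral_congr_ae ?_
  filter_upwards [h.ae_pos] with ω hω
  exact (inner _ hω).2

/-- The moments of the exponentially tilted law as Mellin-Barnes integrals along separating lines
to the right of `-1`. The density itself may be represented only on lines left of `-1`; there the
formula holds for large `n`, and one descends in `n` by integration in `r`. -/
theorem integral_pow_mul_exp_eq [IsFiniteMeasure μ] (h : IsHyperFoxHFading μ X P) {τ : Fin K → ℝ}
    (hτ : ∀ k, (P k).Separates (τ k)) (hτ' : ∀ k, -1 < τ k) (n : ℕ) {s : ℝ} (hs : 0 < s) :
    ((∫ ω, X ω ^ n * Real.exp (-(s * X ω)) ∂μ : ℝ) : ℂ) =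
      ∑ k, (((P k).u : ℂ) / (2 * (Real.pi : ℂ))) *
        ∫ y : ℝ, (P k).laplaceIntegrand n s ((τ k : ℂ) + (y : ℂ) * Complex.I) := by
  obtain ⟨n₀, hn₀⟩ : ∃ n₀ : ℕ, ∀ k, 0 < (P k).contour + n₀ + 1 := by
    have : ∀ᶠ n : ℕ in Filter.atTop, ∀ k, -(P k).contour - 1 < (n : ℝ) :=
      Filter.eventually_all.mpr fun k =>
        tendsto_natCast_atTop_atTop.eventually (Filter.eventually_gt_atTop _)
    obtain ⟨n₀, h0⟩ := this.exists
    exact ⟨n₀, fun k => by linarith [h0 k]⟩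
  have hpos : ∀ k (n : ℕ), 0 < τ k + n + 1 := fun k n => by
    linarith [hτ' k, (Nat.cast_nonneg n : (0 : ℝ) ≤ n)]
  -- `m` bounds the number of descents needed from exponents that are at least `n₀`; all `s` are
  -- treated at once because each descent integrates over `(s, ∞)`.
  have main : ∀ m n : ℕ, n₀ ≤ n + m → ∀ s : ℝ, 0 < s →
      ((∫ ω, X ω ^ n * Real.exp (-(s * X ω)) ∂μ : ℝ) : ℂ) =
      ∑ k, (((P k).u : ℂ) / (2 * (Real.pi : ℂ))) *
        ∫ y : ℝ, (P k).laplaceIntegrand n s ((τ k : ℂ) + (y : ℂ) * Complex.I) := by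
    intro m
    induction m with
    | zero =>
      intro n hn s hs
      have hn' : ∀ k, 0 < (P k).contour + n + 1 := fun k => by
        have : (n₀ : ℝ) ≤ n := by exact_mod_cast hn
        linarith [hn₀ k]
      rw [h.integral_eq_sum_integral (g := fun x => x ^ n * Real.exp (-(s * x))) (by fun_prop)
        fun k => ((h.component k).laplace_foxH hs (hn' k)).1]
      refine Finset.sum_congr rfl fun k _ => ?_
      rw [((h.component k).laplace_foxH hs (hn' k)).2,
        (h.component k).integral_laplaceIntegrand_eq hs (h.component k).isContour_contour.1 (hτ k)
          (hn' k) (hpos k n)]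
    | succ m ih =>
      intro n hn s hs
      have step := fun k => (h.component k).integral_Ioi_laplaceIntegrand hs (hτ k) (hpos k n)
      rw [← h.integral_Ioi_integral_pow_mul_exp n hs]
      refine (integral_ofReal (𝕜 := ℂ)).symm.trans ?_
      calc _ = ∫ r in Set.Ioi s, ∑ k, (((P k).u : ℂ) / (2 * (Real.pi : ℂ))) *
            ∫ y : ℝ, (P k).laplaceIntegrand (n + 1) r ((τ k : ℂ) + (y : ℂ) * Complex.I) :=
          setIntegral_congr_fun measurableSet_Ioi fun r hr =>
            ih (n + 1) (by omega) r (hs.trans hr)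
        _ = _ := by
          rw [integral_finsetSum _ fun k _ => (step k).1.const_mul _]
          refine Finset.sum_congr rfl fun k _ => ?_
          rw [integral_const_mul, (step k).2]
  exact main n₀ n (by omega) s hs

/-- The moment generating function is the sum of the H-functions with the parameters `P_φ`. -/
theorem integral_exp_eq_sum_foxH [IsFiniteMeasure μ] (h : IsHyperFoxHFading μ X P) {s : ℝ}
    (hs : 0 < s) :
    ((∫ ω, Real.exp (-(s * X ω)) ∂μ : ℝ) : ℂ) = ∑ k, (P k).toMGF.foxH s := by
  choose σ hσ using fun k => (h.component k).exists_isContour_toMGF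
  have hsep := fun k => FoxHParam.separates_toMGF_iff.mp (hσ k).1
  have := h.integral_pow_mul_exp_eq (τ := fun k => -1 - σ k) (fun k => (hsep k).2)
    (fun k => by linarith [(hsep k).1]) 0 hs
  simp only [pow_zero, one_mul] at this
  rw [this]
  refine Finset.sum_congr rfl fun k _ => ?_
  rw [(h.component k).foxH_toMGF_eq hs (hσ k).1, (h.component k).toMGF_line_eq hs]

end IsHyperFoxHFading

/-! ### The multivariate H-function -/

theorem Complex.norm_Gamma_le_Gamma_re {z : ℂ} (hz : 0 < z.re) :
    ‖Complex.Gamma z‖ ≤ Real.Gamma z.re := by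
  rw [Complex.Gamma_eq_integral hz, Real.Gamma_eq_integral hz, Complex.GammaIntegral]
  refine (norm_integral_le_integral_norm _).trans (le_of_eq ?_)
  refine setIntegral_congr_fun measurableSet_Ioi fun x hx => ?_
  have hx' : (0 : ℝ) < x := hx
  simp only [norm_mul]
  rw [Complex.norm_cpow_eq_rpow_re_of_pos hx', Complex.norm_real,
    Real.norm_of_nonneg (Real.exp_nonneg _), Complex.sub_re, Complex.one_re]

namespace MultiFoxHParam

variable {N : ℕ} {A : ℝ} {P : Fin N → FoxHParam}

theorem psi_effRate (ζ : Fin N → ℂ) : (effRate N A).psi ζ = Complex.Gamma (A + ∑ l, ζ l) := by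
  simp [psi, effRate]

theorem integrable_prod_kernel_toMGF (h : ∀ j, (P j).IsDensityComponent) {σ : Fin N → ℝ}
    (hσ : ∀ j, (P j).toMGF.Separates (σ j)) :
    Integrable (fun y : Fin N → ℝ => ∏ j, (P j).toMGF.kernel (linePoint σ y j)) :=
  Integrable.fintype_prod
    (f := fun j (y : ℝ) => (P j).toMGF.kernel ((σ j : ℂ) + (y : ℂ) * Complex.I))
    fun j => (h j).integrable_toMGF (hσ j)

theorem re_sum_linePoint (σ y : Fin N → ℝ) :
    ((A : ℂ) + ∑ l, linePoint σ y l).re = A + ∑ l, σ l := by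
  simp [linePoint]

/-- The coupling factor is bounded by `Γ(A + ∑σ_l)`, so integrability reduces to that of a product
of univariate kernels. -/
theorem integrable_psi_effRate (h : ∀ j, (P j).IsDensityComponent) {σ : Fin N → ℝ}
    (hσ : ∀ j, (P j).toMGF.Separates (σ j)) (hA : 0 < A + ∑ l, σ l) :
    Integrable (fun y : Fin N → ℝ =>
      (effRate N A).psi (linePoint σ y) * ∏ j, (P j).toMGF.kernel (linePoint σ y j)) := by
  refine (integrable_prod_kernel_toMGF h hσ).bdd_mul (c := Real.Gamma (A + ∑ l, σ l)) ?_ ?_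
  · refine Continuous.aestronglyMeasurable ?_
    simp only [psi_effRate]
    rw [continuous_iff_continuousAt]
    intro y
    refine ContinuousAt.comp (f := fun y => (A : ℂ) + ∑ l, linePoint σ y l)
      (Complex.differentiableAt_Gamma_of_re_pos (by rwa [re_sum_linePoint])).continuousAt (Continuous.continuousAt ?_)
    simp only [linePoint]
    fun_prop
  · refine Filter.Eventually.of_forall fun y => ?_
    rw [psi_effRate, ← re_sum_linePoint σ y]
    exact Complex.norm_Gamma_le_Gamma_re (by rwa [re_sum_linePoint])

theorem exists_isContour_effRate (hA : 0 < A) (h : ∀ j, (P j).IsDensityComponent) :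
    ∃ σ : Fin N → ℝ, (effRate N A).IsContour (fun j => (P j).toMGF) σ := by
  choose σ hσ hsep using fun j =>
    -- `N` abscissae above `-A/(N+1)` keep `A + ∑σ_l` positive.
    (h j).exists_separates_toMGF (ε := A / (N + 1)) (by positivity)
  have hsum : 0 < A + ∑ l, σ l := by
    have h1 : ∑ _l : Fin N, -(A / (N + 1)) ≤ ∑ l, σ l :=
      Finset.sum_le_sum fun l _ => (hσ l).le
    have h2 : A / ((N : ℝ) + 1) * (N + 1) = A := by field_simp
    have h3 : 0 < A / ((N : ℝ) + 1) := by positivity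
    simp only [Finset.sum_const, Finset.card_univ, Fintype.card_fin, nsmul_eq_mul] at h1
    nlinarith
  refine ⟨σ, hsep, ?_, integrable_psi_effRate h hsep hsum⟩
  intro r hr
  simp only [effRate, List.mem_singleton] at hr
  subst hr
  simpa using hsum

/-- The multivariate H-function as a Gamma-type integral of a product of univariate ones. -/
theorem foxH_effRate_eq (hA : 0 < A) (h : ∀ j, (P j).IsDensityComponent) {a : ℝ} (ha : 0 < a) :
    (effRate N A).foxH (fun _ => a) (fun j => (P j).toMGF) =
      ∫ t in Set.Ioi (0 : ℝ), ((t ^ (A - 1) * Real.exp (-t) : ℝ) : ℂ) *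
        ∏ j, (P j).toMGF.foxH (a * t) ∧
    IntegrableOn (fun t : ℝ => ((t ^ (A - 1) * Real.exp (-t) : ℝ) : ℂ) *
        ∏ j, (P j).toMGF.foxH (a * t)) (Set.Ioi 0) := by
  obtain ⟨hsep, hsum, _⟩ :
      (effRate N A).IsContour (fun j => (P j).toMGF) ((effRate N A).contour fun j => (P j).toMGF) :=
    Classical.epsilon_spec (exists_isContour_effRate hA h)
  rw [foxH]
  set σ := (effRate N A).contour fun j => (P j).toMGF
  replace hsum : 0 < A + ∑ l, σ l := by
    simpa [effRate] using hsum (1 - A, fun _ => 1) (by simp [effRate])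
  have hv : ∀ j, 0 < (P j).toMGF.v := fun j => by
    simpa [FoxHParam.toMGF, FoxHParam.mellinOp, FoxHParam.mgfParam] using (h j).v_pos
  let F : ℝ × (Fin N → ℝ) → ℂ := fun p => ((p.1 ^ (A - 1) * Real.exp (-p.1) : ℝ) : ℂ) *
    ∏ j, ((P j).toMGF.kernel (linePoint σ p.2 j) *
      (((P j).toMGF.v * (a * p.1) : ℝ) : ℂ) ^ (linePoint σ p.2 j))
  have hre : ∀ y j, (linePoint σ y j).re = σ j := fun y j => by simp [linePoint]
  have hint := integrable_prod_kernel_toMGF h hsep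
  have hF : Integrable F ((volume.restrict (Set.Ioi 0)).prod volume) := by
    -- The condition `A + ∑σ_l > 0` gives integrability at `t = 0`.
    refine integrable_prod_Ioi_of_norm_le
      (g := fun t => t ^ (A + ∑ l, σ l - 1) * Real.exp (-(1 * t)))
      (h := fun y => (∏ j, ((P j).toMGF.v * a) ^ σ j) *
        ‖∏ j, (P j).toMGF.kernel (linePoint σ y j)‖) ?_
      (integrableOn_rpow_mul_exp_neg (by linarith) one_pos) (hint.norm.const_mul _) ?_
    · simp only [F, Finset.prod_mul_distrib]
      refine AEStronglyMeasurable.mul (Measurable.aestronglyMeasurable (by fun_prop))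
        (AEStronglyMeasurable.mul hint.aestronglyMeasurable.comp_snd
          (Measurable.aestronglyMeasurable ?_))
      simp only [linePoint]
      fun_prop
    · intro t ht y
      have e : ∀ j, ‖(((P j).toMGF.v * (a * t) : ℝ) : ℂ) ^ (linePoint σ y j)‖ =
          ((P j).toMGF.v * a) ^ σ j * t ^ σ j := fun j => by
        have := hv j
        rw [Complex.norm_cpow_eq_rpow_re_of_pos (by positivity), hre, ← mul_assoc,
          Real.mul_rpow (by positivity) ht.le]
      simp only [F, norm_mul, norm_prod, Finset.prod_mul_distrib, e]
      rw [Complex.norm_real, Real.norm_of_nonneg (by positivity), ← Real.rpow_sum_of_pos ht,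
        one_mul, add_sub_right_comm, Real.rpow_add ht]
      apply le_of_eq
      ring
  have hprod : ∀ t : ℝ, 0 < t → ((t ^ (A - 1) * Real.exp (-t) : ℝ) : ℂ) *
      ∏ j, (P j).toMGF.foxH (a * t) =
      ((∏ j, ((P j).toMGF.u : ℂ)) / (2 * (Real.pi : ℂ)) ^ N) * ∫ y, F (t, y) := by
    intro t ht
    have e : ∀ j, (P j).toMGF.foxH (a * t) = _ := fun j =>
      (h j).foxH_toMGF_eq (mul_pos ha ht) (hsep j)
    simp only [e, Finset.prod_mul_distrib, Finset.prod_div_distrib, Finset.prod_const,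
      Finset.card_univ, Fintype.card_fin]
    -- The product of `N` line integrals is one integral over `ℝ^N`.
    have hfub := integral_fintype_prod_eq_prod (μ := fun _ : Fin N => (volume : Measure ℝ))
      (fun j (y : ℝ) => (P j).toMGF.kernel ((σ j : ℂ) + (y : ℂ) * Complex.I) *
        (((P j).toMGF.v * (a * t) : ℝ) : ℂ) ^ ((σ j : ℂ) + (y : ℂ) * Complex.I))
    rw [← hfub]
    simp only [F, integral_const_mul, linePoint, volume_pi]
    ring
  have hF1 : IntegrableOn (fun t : ℝ => ((t ^ (A - 1) * Real.exp (-t) : ℝ) : ℂ) *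
        ∏ j, (P j).toMGF.foxH (a * t)) (Set.Ioi 0) := by
    refine (hF.integral_prod_left.const_mul
      ((∏ j, ((P j).toMGF.u : ℂ)) / (2 * (Real.pi : ℂ)) ^ N)).congr ?_
    filter_upwards [ae_restrict_mem measurableSet_Ioi] with t ht
    exact (hprod t ht).symm
  refine ⟨?_, hF1⟩
  rw [setIntegral_congr_fun measurableSet_Ioi fun t ht => hprod t ht, integral_const_mul]
  congr 1
  rw [integral_integral_swap (f := fun x y => F (x, y)) hF]
  congr 1
  ext y
  -- For fixed `ζ`, the powers `t^(ζ_l)` combine with `t^(A-1)`, and Euler's integral returns the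
  -- coupling Gamma factor.
  have hG := Complex.integral_cpow_mul_exp_neg_mul_Ioi (a := A + ∑ l, linePoint σ y l) (r := 1)
    (by rwa [re_sum_linePoint]) (by simp)
  simp only [div_one, Complex.one_cpow, one_mul, Complex.ofReal_one] at hG
  rw [psi_effRate, ← hG, mul_comm, ← integral_const_mul]
  refine setIntegral_congr_fun measurableSet_Ioi fun t ht => ?_
  have ht' : (0 : ℝ) < t := ht
  have ht0 : (t : ℂ) ≠ 0 := by exact_mod_cast ht'.ne'
  have e : ∀ j, (((P j).toMGF.v * (a * t) : ℝ) : ℂ) ^ (linePoint σ y j) =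
      (((P j).toMGF.v * a : ℝ) : ℂ) ^ (linePoint σ y j) * (t : ℂ) ^ (linePoint σ y j) := fun j => by
    have := hv j
    rw [← mul_assoc, Complex.ofReal_mul _ t, Complex.mul_cpow_ofReal_nonneg (by positivity) ht'.le]
  have esum : (t : ℂ) ^ (∑ l, linePoint σ y l) = ∏ l, (t : ℂ) ^ linePoint σ y l := by
    simp only [Complex.cpow_def_of_ne_zero ht0, Finset.mul_sum, Complex.exp_sum]
  simp only [F, e]
  rw [add_sub_right_comm, Complex.cpow_add _ _ ht0, esum, Complex.ofReal_mul,
    Complex.ofReal_cpow ht'.le]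
  simp only [Finset.prod_mul_distrib]
  push_cast
  ring

end MultiFoxHParam

/-! ### The effective rate -/

/-- The expectation of `(1 + a ∑ γ_j)^{-A}` through the moment generating functions. -/
theorem integral_one_add_rpow_mul_Gamma {Ω : Type*} [MeasurableSpace Ω] {μ : Measure Ω}
    [IsProbabilityMeasure μ] {N : ℕ} {γ : Fin N → Ω → ℝ} (hm : ∀ j, Measurable (γ j))
    (hpos : ∀ᵐ ω ∂μ, ∀ j, 0 < γ j ω) (hindep : iIndepFun γ μ) {a A : ℝ} (ha : 0 < a) (hA : 0 < A) :
    Real.Gamma A * ∫ ω, (1 + a * ∑ j, γ j ω) ^ (-A) ∂μ =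
      ∫ t in Set.Ioi (0 : ℝ), (t ^ (A - 1) * Real.exp (-t)) *
        ∏ j, ∫ ω, Real.exp (-(a * t * γ j ω)) ∂μ := by
  have hsum : ∀ᵐ ω ∂μ, 0 ≤ ∑ j, γ j ω := by
    filter_upwards [hpos] with ω hω
    exact Finset.sum_nonneg fun j _ => (hω j).le
  have hprod : ∀ t : ℝ, ∏ j, ∫ ω, Real.exp (-(a * t * γ j ω)) ∂μ =
      ∫ ω, Real.exp (-(a * t * ∑ j, γ j ω)) ∂μ := by
    intro t
    -- This is the only use of independence.
    have := hindep.mgf_sum hm Finset.univ (t := -(a * t))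
    simp only [mgf, Finset.sum_apply, neg_mul] at this
    exact this.symm
  have hF : Integrable (fun p : ℝ × Ω => (p.1 ^ (A - 1) * Real.exp (-p.1)) *
      Real.exp (-(a * p.1 * ∑ j, γ j p.2))) ((volume.restrict (Set.Ioi 0)).prod μ) := by
    have hg := (integrableOn_rpow_mul_exp_neg (a := A - 1) (by linarith) one_pos).mul_prod
      (integrable_const (1 : ℝ) (μ := μ))
    refine Integrable.mono' hg (Measurable.aestronglyMeasurable (by fun_prop)) ?_
    have h1 : ∀ᵐ x ∂(volume.restrict (Set.Ioi (0 : ℝ))), x ∈ Set.Ioi (0 : ℝ) :=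
      ae_restrict_mem measurableSet_Ioi
    filter_upwards [Measure.quasiMeasurePreserving_fst.ae h1,
      Measure.quasiMeasurePreserving_snd.ae hsum] with p hp hp'
    have hp0 : 0 < p.1 := hp
    rw [Real.norm_of_nonneg (by positivity), one_mul]
    gcongr
    rw [Real.exp_le_one_iff]
    have : 0 ≤ a * p.1 * ∑ j, γ j p.2 := by positivity
    linarith
  simp only [hprod, ← integral_const_mul]
  rw [integral_integral_swap (f := fun (t : ℝ) ω => (t ^ (A - 1) * Real.exp (-t)) *
      Real.exp (-(a * t * ∑ j, γ j ω))) hF]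
  refine integral_congr_ae ?_
  filter_upwards [hsum] with ω hω
  have hr : 0 < 1 + a * ∑ j, γ j ω := by positivity
  have := Real.integral_rpow_mul_exp_neg_mul_Ioi hA hr
  rw [Real.rpow_neg hr.le, ← Real.inv_rpow hr.le, ← one_div, mul_comm, ← this]
  refine setIntegral_congr_fun measurableSet_Ioi fun t _ => ?_
  rw [mul_assoc, ← Real.exp_add]
  congr 2
  ring

theorem integral_one_add_rpow_pos {Ω : Type*} [MeasurableSpace Ω] {μ : Measure Ω}
    [IsProbabilityMeasure μ] {Y : Ω → ℝ} (hm : Measurable Y) (hpos : ∀ᵐ ω ∂μ, 0 ≤ Y ω) {a A : ℝ}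
    (ha : 0 < a) (hA : 0 < A) : 0 < ∫ ω, (1 + a * Y ω) ^ (-A) ∂μ := by
  have h1 : ∀ᵐ ω ∂μ, 0 < (1 + a * Y ω) ^ (-A) := by
    filter_upwards [hpos] with ω hω
    positivity
  have hint : Integrable (fun ω => (1 + a * Y ω) ^ (-A)) μ := by
    refine Integrable.mono' (integrable_const (1 : ℝ))
      (Measurable.aestronglyMeasurable (by fun_prop)) ?_
    filter_upwards [hpos] with ω hω
    rw [Real.norm_of_nonneg (by positivity)]
    exact Real.rpow_le_one_of_one_le_of_nonpos (by nlinarith [mul_nonneg ha.le hω]) (by linarith)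
  rw [integral_pos_iff_support_of_nonneg_ae (h1.mono fun _ h => h.le) hint]
  refine pos_iff_ne_zero.mpr fun h0 => ?_
  have h2 : ∀ᵐ ω ∂μ, ω ∉ Function.support fun ω => (1 + a * Y ω) ^ (-A) :=
    measure_eq_zero_iff_ae_notMem.mp h0
  obtain ⟨ω, h3, h4⟩ := (h1.and h2).exists
  exact h4 (by simpa using h3.ne')

theorem theorem2 {Ω : Type*} [MeasurableSpace Ω] (μ : Measure Ω) [IsProbabilityMeasure μ]
    (N : ℕ) (hN : 1 ≤ N) (ρ θ T B : ℝ) (hρ : 0 < ρ) (hθ : 0 < θ) (hT : 0 < T) (hB : 0 < B)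
    (γ : Fin N → Ω → ℝ) (hindep : iIndepFun γ μ)
    (K : Fin N → ℕ) (P : (j : Fin N) → Fin (K j) → FoxHParam)
    (hγ : ∀ j, IsHyperFoxHFading μ (γ j) (P j)) :
    -- the sequences `P_φ = P_MGF ⊡ P_f` are the parameter sequences of the individual MGFs
    (∀ j k, ∃ σ : ℝ, (P j k).toMGF.IsContour σ) ∧
    (∀ j (s : ℝ), 0 < s →
      ((∫ ω, Real.exp (-(s * γ j ω)) ∂μ : ℝ) : ℂ) = ∑ k, (P j k).toMGF.foxH s) ∧
    -- every multivariate H-function of the multiple sum exists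
    (∀ k : (j : Fin N) → Fin (K j), ∃ σ : Fin N → ℝ,
      (MultiFoxHParam.effRate N (effRateExponent θ T B)).IsContour
        (fun j => (P j (k j)).toMGF) σ) ∧
    -- the multiple sum is a positive real number `S`, and the effective rate is given by it
    ∃ S : ℝ, 0 < S ∧
      (S : ℂ) = ∑ k : (j : Fin N) → Fin (K j),
        (MultiFoxHParam.effRate N (effRateExponent θ T B)).foxH
          (fun _ => ρ / (N : ℝ)) (fun j => (P j (k j)).toMGF) ∧
      effectiveRate μ γ ρ θ T B =
        -(1 / effRateExponent θ T B) *
          Real.logb 2 (1 / Real.Gamma (effRateExponent θ T B) * S) := by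
  have hA : 0 < effRateExponent θ T B := by
    have := Real.log_pos (by norm_num : (1 : ℝ) < 2)
    unfold effRateExponent
    positivity
  have hN0 : (0 : ℝ) < N := by exact_mod_cast hN
  have ha : 0 < ρ / (N : ℝ) := by positivity
  have hpos : ∀ᵐ ω ∂μ, ∀ j, 0 < γ j ω := ae_all_iff.mpr fun j => (hγ j).ae_pos
  have hm := fun j => (hγ j).measurable
  unfold effectiveRate
  set A := effRateExponent θ T B
  set a := ρ / (N : ℝ)
  have hE : 0 < ∫ ω, (1 + a * ∑ j, γ j ω) ^ (-A) ∂μ :=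
    integral_one_add_rpow_pos (by fun_prop) (hpos.mono fun ω hω =>
      Finset.sum_nonneg fun j _ => (hω j).le) ha hA
  have hG := Real.Gamma_pos_of_pos hA
  have hcomp : ∀ (k : (j : Fin N) → Fin (K j)) j, (P j (k j)).IsDensityComponent :=
    fun k j => (hγ j).component (k j)
  refine ⟨fun j k => ((hγ j).component k).exists_isContour_toMGF,
    fun j s hs => (hγ j).integral_exp_eq_sum_foxH hs,
    fun k => MultiFoxHParam.exists_isContour_effRate hA (hcomp k),
    Real.Gamma A * ∫ ω, (1 + a * ∑ j, γ j ω) ^ (-A) ∂μ, by positivity, ?_, ?_⟩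
  · have hmulti := fun k => MultiFoxHParam.foxH_effRate_eq (P := fun j => P j (k j)) hA (hcomp k) ha
    rw [Finset.sum_congr rfl fun k _ => (hmulti k).1, ← integral_finsetSum _ fun k _ => (hmulti k).2,
      integral_one_add_rpow_mul_Gamma hm hpos hindep ha hA]
    refine (integral_ofReal (𝕜 := ℂ)).symm.trans ?_
    refine setIntegral_congr_fun measurableSet_Ioi fun t ht => ?_
    have ht' : (0 : ℝ) < t := ht
    -- Distributivity: the sum over choices of one component per antenna is the product of the sums
    -- giving the moment generating functions.
    rw [← Finset.mul_sum, ← Fintype.piFinset_univ, ← Finset.prod_univ_sum (fun _ => Finset.univ)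
      fun j k => (P j k).toMGF.foxH (a * t)]
    refine (Complex.ofReal_mul _ _).trans ?_
    rw [Complex.ofReal_prod]
    congr 1
    exact Finset.prod_congr rfl fun j _ => (hγ j).integral_exp_eq_sum_foxH (mul_pos ha ht')
  · rw [one_div (Real.Gamma A), inv_mul_cancel_left₀ hG.ne']
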